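/- Let $\mathcal V$ be an infinite (countable or uncountable) universe of nodes, and let $(L,\le)$ be a pointed dcpo (a poset with a least element $\bot$ in which every directed set has a supremum) that is finitely preceded, i.e. $\{m\in L\mid m<\ell\}$ is finite for every $\ell\in L$. For a strict order $<$ put $\mathrm{succ}^+(x)=\{y\mid x<y\}$, $\mathrm{pred}^+(x)=\{y\mid y<x\}$, $\mathrm{succ}(x)=\{y\mid x<y,\ \neg\exists z.\,x<z<y\}$, $\mathrm{succ}^+(X)=\bigcup_{x\in X}\mathrm{succ}^+(x)$. The level of $x$ is the largest $n$ for which there are a minimal element $x_0$ and $x_1,\dots,x_n=x$ with $x_{i+1}\in\mathrm{succ}(x_i)$ for all $i<n$. A labelled partial order with formulae (LPOF) over $L$ is a tuple $\alpha=\langle N,<,\lambda,\varphi\rangle$ where $N\subseteq\mathcal V$ is countable; $<$ is a strict partial order on $N$ in which every $\mathrm{pred}^+(x)$ is finite, every level contains finitely many nodes, and there is exactly one minimal element; $\lambda:N\to L$ satisfies $\mathrm{succ}(x)=\emptyset$ whenever $\lambda(x)=\bot$; and $\varphi$ assigns to every $x\in N$ a satisfiable Boolean formula whose variables belong to $\mathrm{pred}^+(x)$,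 such that $\varphi(y)\Rightarrow\varphi(x)$ whenever $x<y$. Formulae are identified up to logical equivalence $\Leftrightarrow$ when LPOFs are compared. An isomorphism of LPOFs is a bijection of the node sets that preserves and reflects $<$, preserves labels, and carries $\varphi$ (with variables renamed along the bijection) to $\varphi$ up to $\Leftrightarrow$. Put $\mathrm{Bot}_\alpha=\{x\in N_\alpha\mid\lambda_\alpha(x)=\bot\}$ and let $\alpha\sqsubseteq\beta$ mean: $N_\alpha$ is a downward closed subset of $N_\beta$; $<_\alpha$ is the restriction of $<_\beta$ to $N_\alpha$; and for all $x\in N_\alpha$: $\lambda_\alpha(x)\le\lambda_\beta(x)$, $\varphi_\alpha(x)\Leftrightarrow\varphi_\beta(x)$ and $\mathrm{succ}_\alpha(x)=\mathrm{succ}_\beta(x)\setminus\mathrm{succ}^+_\beta(\mathrm{Bot}_\alpha)$. In the preorder $\sqsubseteq$, a supremum is a least upper bound. Let $\mathrm{Pom}(L)$ be the set of isomorphism classes $[\alpha]$ of LPOFs (pomsets with formulae), and let $A\sqsubseteq_{\mathrm{Pom}}B$ mean that for every $\alpha\in A$ for which $\mathcal V\setminus N_\alpha$ is infinite there is $\beta\in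 B$ with $\alpha\sqsubseteq\beta$. (If $\mathcal V$ is uncountable, the condition on $\alpha$ always holds.) Then: 1. $(\mathrm{Pom}(L),\sqsubseteq_{\mathrm{Pom}})$ is a pointed dcpo: $\sqsubseteq_{\mathrm{Pom}}$ is a partial order, every directed set has a supremum, and there is a least element. 2. Let $(A_i)_{i\in I}$ be a chain of pomsets indexed by a non-empty well-ordered set $I$, with $A_i\sqsubseteq_{\mathrm{Pom}}A_j$ for $i\le j$. There are representatives $\alpha_i\in A_i$ with $\alpha_i\sqsubseteq\alpha_j$ for $i\le j$; and for every such choice of representatives, $(\alpha_i)_{i\in I}$ has a supremum $\alpha$ in the LPOFs, and $[\alpha]$ is the supremum of $(A_i)_{i\in I}$. 3. For every non-empty directed set $D\subseteq\mathrm{Pom}(L)$ there is a chain of LPOFs $\alpha_0\sqsubseteq\alpha_1\sqsubseteq\cdots$ with $[\alpha_n]\in D$ for all $n$, which has a supremum $\alpha$ in the LPOFs, and $[\alpha]$ is the supremum of $D$. -/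

import Mathlib

/-! ### Order-theoretic notions, for a relation `r` on a type -/

/-- `s` is a supremum (least upper bound) of `S` with respect to `r`. -/
def IsSupOf {X : Type*} (r : X → X → Prop) (S : Set X) (s : X) : Prop :=
  (∀ a ∈ S, r a s) ∧ ∀ b, (∀ a ∈ S, r a b) → r s b

/-- `r` is a partial order for which every directed set has a supremum, and which has a least
element. (As there is a least element, it does not matter whether the empty set counts as
directed.) -/
structure IsPointedDcpo {X : Type*} (r : X → X → Prop) : Prop where
  refl : ∀ a, r a a
  trans : ∀ a b c, r a b → r b c → r a c
  antisymm : ∀ a b, r a b → r b a → a = b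
  exists_sup : ∀ D : Set X, DirectedOn r D → ∃ s, IsSupOf r D s
  exists_bot : ∃ b, ∀ a, r b a

/-! ### Strict orders on a set of nodes -/

section StrictOrders

variable {V : Type*}

/-- All elements strictly above `x`. -/
def above (lt : V → V → Prop) (x : V) : Set V := {y | lt x y}

/-- All elements strictly below `x`. -/
def below (lt : V → V → Prop) (x : V) : Set V := {y | lt y x}

/-- The immediate successors of `x`. -/
def immSucc (lt : V → V → Prop) (x : V) : Set V := {y | lt x y ∧ ¬ ∃ z, lt x z ∧ lt z y}

/-- The immediate predecessors of `x`. -/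
def immPred (lt : V → V → Prop) (x : V) : Set V := {y | lt y x ∧ ¬ ∃ z, lt y z ∧ lt z x}

/-- The minimal elements of the strict poset `(N, lt)`. -/
def minNodes (N : Set V) (lt : V → V → Prop) : Set V := {x | x ∈ N ∧ immPred lt x = ∅}

/-- The level of `x`: the largest length of a chain of immediate successors that leads from a
minimal element to `x`. -/
noncomputable def level (N : Set V) (lt : V → V → Prop) (x : V) : ℕ :=
  sSup {n | ∃ c : ℕ → V, c 0 ∈ minNodes N lt ∧ c n = x ∧ ∀ i < n, c (i + 1) ∈ immSucc lt (c i)}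

end StrictOrders

/-! ### Boolean formulae -/

/-- Boolean formulae with variables in `V`. -/
inductive Formula (V : Type*) where
  | tru : Formula V
  | fls : Formula V
  | conj : Formula V → Formula V → Formula V
  | disj : Formula V → Formula V → Formula V
  | neg : Formula V → Formula V
  | var : V → Formula V

namespace Formula

/-- Satisfaction of a formula by a valuation. -/
def Holds {V : Type*} (v : V → Bool) : Formula V → Prop
  | tru => True
  | fls => False
  | conj a b => Holds v a ∧ Holds v b
  | disj a b => Holds v a ∨ Holds v b
  | neg a => ¬ Holds v a
  | var x => v x = true

/-- The variables that occur in a formula. -/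
def free {V : Type*} : Formula V → Set V
  | tru => ∅
  | fls => ∅
  | conj a b => free a ∪ free b
  | disj a b => free a ∪ free b
  | neg a => free a
  | var x => {x}

/-- Renaming of the variables of a formula. -/
def rename {V W : Type*} (f : V → W) : Formula V → Formula W
  | tru => tru
  | fls => fls
  | conj a b => conj (rename f a) (rename f b)
  | disj a b => disj (rename f a) (rename f b)
  | neg a => neg (rename f a)
  | var x => var (f x)

/-- Some valuation satisfies the formula. -/
def Satisfiable {V : Type*} (a : Formula V) : Prop := ∃ v, Holds v a

/-- Every valuation that satisfies `a` satisfies `b`. -/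
def Implies {V : Type*} (a b : Formula V) : Prop := ∀ v, Holds v a → Holds v b

/-- Logical equivalence. -/
def Equivalent {V : Type*} (a b : Formula V) : Prop := Implies a b ∧ Implies b a

theorem holds_rename {V W : Type*} (f : V → W) (v : W → Bool) (a : Formula V) :
    Holds v (rename f a) ↔ Holds (v ∘ f) a := by
  induction a <;> simp_all [Holds, rename]

theorem holds_congr {V : Type*} (v w : V → Bool) (a : Formula V)
    (h : ∀ x ∈ free a, v x = w x) : Holds v a ↔ Holds w a := by
  induction a with
  | tru => exact Iff.rfl
  | fls => exact Iff.rfl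
  | conj a b iha ihb =>
    exact and_congr (iha fun x hx => h x (Or.inl hx)) (ihb fun x hx => h x (Or.inr hx))
  | disj a b iha ihb =>
    exact or_congr (iha fun x hx => h x (Or.inl hx)) (ihb fun x hx => h x (Or.inr hx))
  | neg a iha => exact not_congr (iha h)
  | var x => simp [Holds, h x rfl]

end Formula

/-! ### Labelled partial orders with formulae -/

/-- A labelled partial order with formulae over the pointed poset `L` of labels, with nodes in the
universe `V`. The labelling and the formula function are meant on `nodes` only: their values
elsewhere are never used (in particular not by the order and the isomorphisms below). -/
structure LPOF (V L : Type*) [PartialOrder L] [OrderBot L] where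
  nodes : Set V
  lt : V → V → Prop
  label : V → L
  form : V → Formula V
  countable : nodes.Countable
  mem_of_lt : ∀ x y, lt x y → x ∈ nodes ∧ y ∈ nodes
  irrefl : ∀ x, ¬ lt x x
  trans : ∀ x y z, lt x y → lt y z → lt x z
  finitely_preceded : ∀ x ∈ nodes, (below lt x).Finite
  level_finite : ∀ n : ℕ, {x | x ∈ nodes ∧ level nodes lt x = n}.Finite
  single_rooted : ∃ r, minNodes nodes lt = {r}
  succ_of_bot : ∀ x ∈ nodes, label x = ⊥ → immSucc lt x = ∅
  form_sat : ∀ x ∈ nodes, (form x).Satisfiable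
  form_free : ∀ x ∈ nodes, (form x).free ⊆ below lt x
  form_imp : ∀ x y, lt x y → (form y).Implies (form x)

namespace LPOF

variable {V L : Type*} [PartialOrder L] [OrderBot L]

/-- The nodes labelled with `⊥`. -/
def bots (a : LPOF V L) : Set V := {x | x ∈ a.nodes ∧ a.label x = ⊥}

/-- The order on LPOFs; formulae are compared up to logical equivalence. -/
structure Le (a b : LPOF V L) : Prop where
  nodes_subset : a.nodes ⊆ b.nodes
  down_closed : ∀ y ∈ a.nodes, below b.lt y ⊆ a.nodes
  lt_iff : ∀ x y, a.lt x y ↔ b.lt x y ∧ x ∈ a.nodes ∧ y ∈ a.nodes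
  label_le : ∀ x ∈ a.nodes, a.label x ≤ b.label x
  form_eq : ∀ x ∈ a.nodes, (a.form x).Equivalent (b.form x)
  succ_eq : ∀ x ∈ a.nodes, immSucc a.lt x = immSucc b.lt x \ ⋃ z ∈ a.bots, above b.lt z

/-- Isomorphism of LPOFs: a bijection between the sets of nodes that carries the order, the
labels and the formulae (with renamed variables, and up to logical equivalence) of one to those of
the other. -/
def Iso (a b : LPOF V L) : Prop :=
  ∃ f : V → V, Set.BijOn f a.nodes b.nodes ∧
    (∀ x ∈ a.nodes, ∀ y ∈ a.nodes, (a.lt x y ↔ b.lt (f x) (f y))) ∧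
    (∀ x ∈ a.nodes, b.label (f x) = a.label x) ∧
    (∀ x ∈ a.nodes, (b.form (f x)).Equivalent ((a.form x).rename f))

theorem form_free_nodes (a : LPOF V L) {x y : V} (hx : x ∈ a.nodes) (hy : y ∈ (a.form x).free) :
    y ∈ a.nodes :=
  (a.mem_of_lt _ _ (a.form_free x hx hy)).1

theorem iso_refl (a : LPOF V L) : Iso a a := by
  refine ⟨id, Set.bijOn_id _, fun _ _ _ _ => Iff.rfl, fun _ _ => rfl, fun x _ => ⟨?_, ?_⟩⟩ <;>
  · intro v h
    simpa [Formula.holds_rename] using h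

theorem iso_symm {a b : LPOF V L} (h : Iso a b) : Iso b a := by
  obtain ⟨f, hf, hlt, hlab, hform⟩ := h
  rcases isEmpty_or_nonempty V with hV | hV
  · refine ⟨id, ⟨fun x => isEmptyElim x, fun x => isEmptyElim x, fun x => isEmptyElim x⟩,
      fun x => isEmptyElim x, fun x => isEmptyElim x, fun x => isEmptyElim x⟩
  have hinv : Set.InvOn (Function.invFunOn f a.nodes) f a.nodes b.nodes := hf.invOn_invFunOn
  have hg : Set.BijOn (Function.invFunOn f a.nodes) b.nodes a.nodes := hf.symm hinv.symm
  refine ⟨Function.invFunOn f a.nodes, hg, ?_, ?_, ?_⟩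
  · intro x hx y hy
    rw [hlt _ (hg.mapsTo hx) _ (hg.mapsTo hy), hinv.2 hx, hinv.2 hy]
  · intro x hx
    rw [← hlab _ (hg.mapsTo hx), hinv.2 hx]
  · intro x hx
    have key : ∀ v : V → Bool, Formula.Holds v (a.form (Function.invFunOn f a.nodes x)) ↔
        Formula.Holds v ((b.form x).rename (Function.invFunOn f a.nodes)) := by
      intro v
      have h1 := hform _ (hg.mapsTo hx)
      rw [hinv.2 hx] at h1
      rw [Formula.holds_rename]
      have h2 : Formula.Holds (v ∘ Function.invFunOn f a.nodes) (b.form x) ↔ _ :=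
        ⟨h1.1 _, h1.2 _⟩
      rw [h2, Formula.holds_rename]
      refine Formula.holds_congr _ _ _ fun y hy => ?_
      simp [hinv.1 (a.form_free_nodes (hg.mapsTo hx) hy)]
    exact ⟨fun v => (key v).1, fun v => (key v).2⟩

theorem iso_trans {a b c : LPOF V L} (h : Iso a b) (h' : Iso b c) : Iso a c := by
  obtain ⟨f, hf, hlt, hlab, hform⟩ := h
  obtain ⟨g, hg, hlt', hlab', hform'⟩ := h'
  refine ⟨g ∘ f, hg.comp hf, ?_, ?_, ?_⟩
  · intro x hx y hy
    rw [hlt x hx y hy, hlt' _ (hf.mapsTo hx) _ (hf.mapsTo hy)]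
    rfl
  · intro x hx
    rw [Function.comp_apply, hlab' _ (hf.mapsTo hx), hlab x hx]
  · intro x hx
    have key : ∀ v : V → Bool, Formula.Holds v (c.form ((g ∘ f) x)) ↔
        Formula.Holds v ((a.form x).rename (g ∘ f)) := by
      intro v
      have h1 := hform _ hx
      have h2 := hform' _ (hf.mapsTo hx)
      have h3 : Formula.Holds v (c.form (g (f x))) ↔ _ := ⟨h2.1 v, h2.2 v⟩
      have h4 : Formula.Holds (v ∘ g) (b.form (f x)) ↔ _ := ⟨h1.1 _, h1.2 _⟩
      rw [Function.comp_apply, h3, Formula.holds_rename, h4, Formula.holds_rename,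
        Formula.holds_rename]
      rfl
    exact ⟨fun v => (key v).1, fun v => (key v).2⟩

instance isoSetoid (V L : Type*) [PartialOrder L] [OrderBot L] : Setoid (LPOF V L) where
  r := Iso
  iseqv := ⟨iso_refl, iso_symm, iso_trans⟩

end LPOF

/-! ### Pomsets with formulae -/

/-- Pomsets with formulae: isomorphism classes of LPOFs. -/
def Pom (V L : Type*) [PartialOrder L] [OrderBot L] : Type _ := Quotient (LPOF.isoSetoid V L)

namespace Pom

variable {V L : Type*} [PartialOrder L] [OrderBot L]

/-- The isomorphism class of an LPOF. -/
def mk (a : LPOF V L) : Pom V L := Quotient.mk (LPOF.isoSetoid V L) a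

/-- The LPOFs that belong to a pomset. -/
def reps (A : Pom V L) : Set (LPOF V L) := {a | mk a = A}

/-- The order on pomsets: every representative `a` of `A` lies below some representative of `B`.
Here `a` has to leave infinitely many nodes of the universe unused, so that fresh nodes are
available. For an uncountable universe every LPOF does (see `le_iff_of_uncountable`); a countable
universe may be exhausted by an infinite representative `a`, which then could not be extended
although isomorphic copies of it can. -/
def Le (A B : Pom V L) : Prop :=
  ∀ a ∈ A.reps, a.nodesᶜ.Infinite → ∃ b ∈ B.reps, a.Le b

theorem le_iff_of_uncountable [Uncountable V] (A B : Pom V L) :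
    A.Le B ↔ ∀ a ∈ A.reps, ∃ b ∈ B.reps, a.Le b := by
  refine ⟨fun h a ha => h a ha fun hfin => ?_, fun h a ha _ => h a ha⟩
  have : (Set.univ : Set V).Countable := by
    rw [← Set.union_compl_self a.nodes]
    exact a.countable.union hfin.countable
  exact Set.not_countable_univ this

end Pom

/-! By `Pom.mk_le_mk`, the order on pomsets is the existence of an `LPOF.Emb`: an order embedding
that respects formulae, may raise labels, and misses only nodes above the image of a `⊥`-labelled
node. For inclusions this covering condition is equivalent to the successor equation in `LPOF.Le`
(`Le.cover`, `Emb.le`). It makes the image downward closed, so embeddings preserve levels.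

As levels are finite, a self-embedding moves every node in a cycle, which gives antisymmetry
(`Emb.iso_of_emb`). Finiteness also gives compactness: embeddings of the parts below level `n`, for
all `n`, yield an embedding of the whole (`exists_emb_limit`).

Suprema come from stabilisation. Labels satisfy the ascending chain condition, and new nodes appear
only above nodes labelled `⊥`, so above any member of a family some member is fixed on the levels
below `n` (`exists_stable`). Hence the union of a chain is an LPOF whose part below level `n`
already occurs in one member (`exists_chain_union`). For a directed `D`, take a chain whose `n`-th
term is stable below `n`. A member of `D` and this term have a common upper bound in `D`, which has
nothing new below `n`; so the member embeds into the union below every `n`, and compactness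
finishes.

To choose representatives of a transfinite chain, embed finitely many terms coherently into one
upper bound, pass to a limit along an ultrafilter, and take the images. -/

section LevelTheory

/-! ### Levels in finitely preceded strict orders -/

variable {V W : Type*}

/-- Some chain of `n` immediate successors leads from a minimal element to `x`. -/
inductive Reach (N : Set V) (lt : V → V → Prop) : ℕ → V → Prop
  | zero {x : V} : x ∈ minNodes N lt → Reach N lt 0 x
  | succ {n : ℕ} {x y : V} : Reach N lt n x → y ∈ immSucc lt x → Reach N lt (n + 1) y

theorem reach_iff_exists_chain {N : Set V} {lt : V → V → Prop} {n : ℕ} {x : V} :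
    Reach N lt n x ↔ ∃ c : ℕ → V, c 0 ∈ minNodes N lt ∧ c n = x ∧
      ∀ i < n, c (i + 1) ∈ immSucc lt (c i) := by
  constructor
  · intro h
    induction h with
    | @zero x hx => exact ⟨fun _ => x, hx, rfl, fun i hi => absurd hi (Nat.not_lt_zero i)⟩
    | @succ n x y _ hy ih =>
      obtain ⟨c, h0, hn, hc⟩ := ih
      refine ⟨fun i => if i ≤ n then c i else y, by simpa using h0, by simp, fun i hi => ?_⟩
      rcases Nat.lt_succ_iff_lt_or_eq.1 hi with h | rfl
      · simpa [h.le, Nat.succ_le_of_lt h] using hc i h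
      · simpa [hn] using hy
  · rintro ⟨c, h0, rfl, hc⟩
    induction n with
    | zero => exact .zero h0
    | succ n ih => exact .succ (ih fun i hi => hc i (hi.trans n.lt_succ_self)) (hc n n.lt_succ_self)

theorem level_eq_sSup_reach (N : Set V) (lt : V → V → Prop) (x : V) :
    level N lt x = sSup {n | Reach N lt n x} := by
  simp only [level, reach_iff_exists_chain]

/-- Take a maximal element of the finite set below `y`, chosen above or equal to `x`. -/
theorem exists_immSucc_between {lt : V → V → Prop} (trans : ∀ x y z, lt x y → lt y z → lt x z)
    (irrefl : ∀ x, ¬ lt x x) {x y : V} (hfin : (below lt y).Finite) (h : lt x y) :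
    ∃ z, (x = z ∨ lt x z) ∧ y ∈ immSucc lt z := by
  let _ : Preorder V :=
    { le := fun a b => a = b ∨ lt a b
      lt := lt
      le_refl := fun a => Or.inl rfl
      le_trans := by
        rintro a b c (rfl | h1) (rfl | h2)
        · exact Or.inl rfl
        · exact Or.inr h2
        · exact Or.inr h1
        · exact Or.inr (trans _ _ _ h1 h2)
      lt_iff_le_not_ge := by
        intro a b
        refine ⟨fun h => ⟨Or.inr h, ?_⟩, ?_⟩
        · rintro (rfl | h')
          · exact irrefl _ h
          · exact irrefl _ (trans _ _ _ h h')
        · rintro ⟨rfl | h1, h2⟩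
          · exact absurd (Or.inl rfl) h2
          · exact h1 }
  obtain ⟨z, hxz, hz⟩ := hfin.exists_le_maximal (a := x) h
  exact ⟨z, hxz, hz.prop, fun ⟨w, hzw, hwy⟩ => hz.not_prop_of_gt hzw hwy⟩

theorem mem_minNodes_iff {N : Set V} {lt : V → V → Prop}
    (trans : ∀ x y z, lt x y → lt y z → lt x z) (irrefl : ∀ x, ¬ lt x x)
    (hfin : ∀ x ∈ N, (below lt x).Finite) {x : V} :
    x ∈ minNodes N lt ↔ x ∈ N ∧ ∀ y, ¬ lt y x := by
  refine and_congr_right fun hx => ⟨fun h y hy => ?_, fun h => ?_⟩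
  · obtain ⟨z, -, hz⟩ := exists_immSucc_between trans irrefl (hfin x hx) hy
    exact (Set.ext_iff.1 h z).1 hz
  · exact Set.eq_empty_iff_forall_notMem.2 fun y hy => h y hy.1

/-- Each step of a chain strictly enlarges the set of predecessors. This bounds the chain lengths,
so the `sSup` in `level` is a genuine maximum. -/
theorem le_ncard_below_of_reach {N : Set V} {lt : V → V → Prop}
    (trans : ∀ x y z, lt x y → lt y z → lt x z) (irrefl : ∀ x, ¬ lt x x)
    (mem : ∀ x y, lt x y → x ∈ N ∧ y ∈ N)
    (hfin : ∀ x ∈ N, (below lt x).Finite) {n : ℕ} {x : V} (h : Reach N lt n x) :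
    n ≤ (below lt x).ncard := by
  induction h with
  | zero _ => exact Nat.zero_le _
  | @succ n x y _ hy ih =>
    refine (Nat.succ_le_succ ih).trans (Nat.succ_le_of_lt ?_)
    refine Set.ncard_lt_ncard ⟨fun z hz => trans _ _ _ hz hy.1, fun hsub => ?_⟩
      (hfin y (mem _ _ hy.1).2)
    exact irrefl x (hsub hy.1)

theorem exists_reach {N : Set V} {lt : V → V → Prop}
    (trans : ∀ x y z, lt x y → lt y z → lt x z) (irrefl : ∀ x, ¬ lt x x)
    (mem : ∀ x y, lt x y → x ∈ N ∧ y ∈ N)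
    (hfin : ∀ x ∈ N, (below lt x).Finite) {x : V} (hx : x ∈ N) : ∃ n, Reach N lt n x := by
  induction hk : (below lt x).ncard using Nat.strong_induction_on generalizing x with
  | _ k ih =>
    by_cases h : ∃ y, lt y x
    · obtain ⟨y, hy⟩ := h
      obtain ⟨z, -, hz⟩ := exists_immSucc_between trans irrefl (hfin x hx) hy
      have hlt : (below lt z).ncard < k := hk ▸ Set.ncard_lt_ncard
        ⟨fun w hw => trans _ _ _ hw hz.1, fun hsub => irrefl z (hsub hz.1)⟩ (hfin x hx)
      obtain ⟨n, hn⟩ := ih _ hlt (mem _ _ hz.1).1 rfl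
      exact ⟨n + 1, hn.succ hz⟩
    · exact ⟨0, .zero ((mem_minNodes_iff trans irrefl hfin).2 ⟨hx, not_exists.1 h⟩)⟩

/-- A chain to `x` is prolonged to `y` through an immediate predecessor of `y` that is `x` or above
it. -/
theorem exists_reach_of_lt {N : Set V} {lt : V → V → Prop}
    (trans : ∀ x y z, lt x y → lt y z → lt x z) (irrefl : ∀ x, ¬ lt x x)
    (mem : ∀ x y, lt x y → x ∈ N ∧ y ∈ N)
    (hfin : ∀ x ∈ N, (below lt x).Finite) {n : ℕ} {x y : V} (h : Reach N lt n x)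
    (hxy : lt x y) : ∃ m, n < m ∧ Reach N lt m y := by
  induction hk : (below lt y).ncard using Nat.strong_induction_on generalizing y with
  | _ k ih =>
    have hy := hfin y (mem _ _ hxy).2
    obtain ⟨z, hxz, hz⟩ := exists_immSucc_between trans irrefl hy hxy
    rcases hxz with rfl | hxz
    · exact ⟨n + 1, n.lt_succ_self, h.succ hz⟩
    · have hlt : (below lt z).ncard < k := hk ▸ Set.ncard_lt_ncard
        ⟨fun w hw => trans _ _ _ hw hz.1, fun hsub => irrefl z (hsub hz.1)⟩ hy
      obtain ⟨m, hm, hr⟩ := ih _ hlt hxz rfl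
      exact ⟨m + 1, hm.trans m.lt_succ_self, hr.succ hz⟩

theorem level_lt_level {N : Set V} {lt : V → V → Prop}
    (trans : ∀ x y z, lt x y → lt y z → lt x z) (irrefl : ∀ x, ¬ lt x x)
    (mem : ∀ x y, lt x y → x ∈ N ∧ y ∈ N)
    (hfin : ∀ x ∈ N, (below lt x).Finite) {x y : V} (hxy : lt x y) :
    level N lt x < level N lt y := by
  have bdd : ∀ z, BddAbove {n | Reach N lt n z} := fun z =>
    ⟨_, fun n hn => le_ncard_below_of_reach trans irrefl mem hfin hn⟩
  have hx : Reach N lt (level N lt x) x := by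
    rw [level_eq_sSup_reach]
    exact Nat.sSup_mem (exists_reach trans irrefl mem hfin (mem _ _ hxy).1) (bdd x)
  obtain ⟨m, hm, hr⟩ := exists_reach_of_lt trans irrefl mem hfin hx hxy
  rw [level_eq_sSup_reach N lt y]
  exact hm.trans_le (le_csSup (bdd y) hr)

/-- Levels are preserved by order embeddings onto downward closed subsets. -/
theorem level_map {N : Set V} {lt : V → V → Prop} {N' : Set W} {lt' : W → W → Prop} {f : V → W}
    (mem : ∀ x y, lt x y → x ∈ N ∧ y ∈ N) (maps : ∀ x ∈ N, f x ∈ N')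
    (lt_iff : ∀ x ∈ N, ∀ y ∈ N, lt x y ↔ lt' (f x) (f y))
    (down : ∀ x ∈ N, ∀ y, lt' y (f x) → ∃ w ∈ N, f w = y) {x : V} (hx : x ∈ N) :
    level N' lt' (f x) = level N lt x := by
  have imm : ∀ x ∈ N, ∀ y ∈ N, (f y ∈ immSucc lt' (f x) ↔ y ∈ immSucc lt x) := by
    intro x hx y hy
    refine and_congr (lt_iff x hx y hy).symm (not_congr ⟨?_, ?_⟩)
    · rintro ⟨z, hxz, hzy⟩
      obtain ⟨w, hw, rfl⟩ := down y hy z hzy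
      exact ⟨w, (lt_iff x hx w hw).2 hxz, (lt_iff w hw y hy).2 hzy⟩
    · rintro ⟨z, hxz, hzy⟩
      have hz := (mem _ _ hzy).1
      exact ⟨f z, (lt_iff x hx z hz).1 hxz, (lt_iff z hz y hy).1 hzy⟩
  have key : ∀ n, ∀ x ∈ N, Reach N' lt' n (f x) ↔ Reach N lt n x := by
    intro n
    induction n with
    | zero =>
      intro x hx
      have : f x ∈ minNodes N' lt' ↔ x ∈ minNodes N lt := by
        simp only [minNodes, Set.mem_ofPred_eq, hx, maps x hx, true_and,
          Set.eq_empty_iff_forall_notMem]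
        refine ⟨fun h y hy => h (f y) ((imm y (mem _ _ hy.1).1 x hx).2 hy), fun h y hy => ?_⟩
        obtain ⟨w, hw, rfl⟩ := down x hx y hy.1
        exact h w ((imm w hw x hx).1 hy)
      refine ⟨fun h => ?_, fun h => ?_⟩
      · cases h with | zero h => exact .zero (this.1 h)
      · cases h with | zero h => exact .zero (this.2 h)
    | succ n ih =>
      intro x hx
      refine ⟨fun h => ?_, fun h => ?_⟩
      · cases h with
        | @succ _ y _ h hy =>
          obtain ⟨w, hw, rfl⟩ := down x hx y hy.1
          exact ((ih w hw).1 h).succ ((imm w hw x hx).1 hy)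
      · cases h with
        | @succ _ y _ h hy =>
          have hyN := (mem _ _ hy.1).1
          exact ((ih y hyN).2 h).succ ((imm y hyN x hx).2 hy)
  simp only [level_eq_sSup_reach, key _ x hx]

end LevelTheory

/-! ### Renaming of formulae and extension of injections -/

theorem Formula.free_rename {V W : Type*} (f : V → W) (a : Formula V) :
    (a.rename f).free = f '' a.free := by
  induction a <;> simp_all [Formula.free, Formula.rename, Set.image_union]

theorem Formula.equivalent_iff {V : Type*} {a b : Formula V} :
    a.Equivalent b ↔ ∀ v, a.Holds v ↔ b.Holds v :=
  ⟨fun h v => ⟨h.1 v, h.2 v⟩, fun h => ⟨fun v => (h v).1, fun v => (h v).2⟩⟩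

/-- An injection on part of a countable set extends to the whole set by means of fresh elements,
infinitely many of which are left over. -/
theorem Set.InjOn.exists_extension {V : Type*} {M N : Set V} {f : V → V} (hf : Set.InjOn f M)
    (hN : N.Countable) (hinf : (f '' M)ᶜ.Infinite) :
    ∃ h : V → V, Set.InjOn h N ∧ Set.EqOn h f M ∧ (h '' N)ᶜ.Infinite := by
  classical
  obtain ⟨enc, henc⟩ := Set.countable_iff_exists_injOn.1 hN
  let e := hinf.natEmbedding
  have he : ∀ n, ∀ x ∈ M, f x ≠ e n := fun n x hx h => (e n).2 (h ▸ ⟨x, hx, rfl⟩)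
  have hinj : ∀ m n, (e m : V) = e n → m = n := fun m n h => e.injective (Subtype.ext h)
  -- Fresh values have even index in `e`; the odd ones stay unused.
  refine ⟨fun x => if x ∈ M then f x else e (2 * enc x), ?_, fun x hx => if_pos hx, ?_⟩
  · intro x hx y hy hxy
    by_cases h1 : x ∈ M <;> by_cases h2 : y ∈ M <;> simp only [h1, h2, if_true, if_false] at hxy
    · exact hf h1 h2 hxy
    · exact absurd hxy (he _ _ h1)
    · exact absurd hxy.symm (he _ _ h2)
    · exact henc hx hy (by have := hinj _ _ hxy; omega)
  · refine (Set.infinite_range_of_injective (f := fun n : ℕ => (e (2 * n + 1) : V))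
      fun m n h => by have := hinj _ _ h; omega).mono ?_
    rintro _ ⟨n, rfl⟩ ⟨x, -, hx⟩
    by_cases h1 : x ∈ M <;> simp only [h1, if_true, if_false] at hx
    · exact he _ _ h1 hx
    · have := hinj _ _ hx; omega

/-! ### Embeddings of LPOFs -/

namespace LPOF

variable {V L : Type*} [PartialOrder L] [OrderBot L] {a b c : LPOF V L}

/-- The level of a node. -/
noncomputable def lvl (a : LPOF V L) (x : V) : ℕ := level a.nodes a.lt x

theorem lvl_lt (a : LPOF V L) {x y : V} (h : a.lt x y) : a.lvl x < a.lvl y :=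
  level_lt_level a.trans a.irrefl a.mem_of_lt a.finitely_preceded h

theorem finite_lvl_lt (a : LPOF V L) (n : ℕ) : {x | x ∈ a.nodes ∧ a.lvl x < n}.Finite := by
  refine ((Set.finite_lt_nat n).biUnion fun k _ => a.level_finite k).subset ?_
  rintro x ⟨hx, hn⟩
  exact Set.mem_biUnion (show a.lvl x ∈ {i | i < n} from hn) ⟨hx, rfl⟩

theorem exists_immSucc (a : LPOF V L) {x y : V} (h : a.lt x y) :
    ∃ z, (x = z ∨ a.lt x z) ∧ y ∈ immSucc a.lt z :=
  exists_immSucc_between a.trans a.irrefl (a.finitely_preceded y (a.mem_of_lt _ _ h).2) h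

/-- The axiom only excludes immediate successors; an immediate predecessor of `y` reduces to that
case or to a lower level. -/
theorem not_lt_of_label_eq_bot (a : LPOF V L) {x y : V} (h : a.label x = ⊥) : ¬ a.lt x y := by
  induction hn : a.lvl y using Nat.strong_induction_on generalizing y with
  | _ n ih =>
    intro hxy
    obtain ⟨z, rfl | hxz, hz⟩ := a.exists_immSucc hxy
    · rw [a.succ_of_bot x (a.mem_of_lt _ _ hxy).1 h] at hz
      exact hz
    · exact ih _ (hn ▸ a.lvl_lt hz.1) rfl hxz

theorem mem_minNodes (a : LPOF V L) {x : V} :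
    x ∈ minNodes a.nodes a.lt ↔ x ∈ a.nodes ∧ ∀ y, ¬ a.lt y x :=
  mem_minNodes_iff a.trans a.irrefl a.finitely_preceded

theorem exists_root (a : LPOF V L) :
    ∃ r ∈ a.nodes, (∀ y, ¬ a.lt y r) ∧ ∀ x ∈ a.nodes, x = r ∨ a.lt r x := by
  obtain ⟨r, hr⟩ := a.single_rooted
  have hr' := a.mem_minNodes.1 (hr ▸ Set.mem_singleton r : r ∈ minNodes a.nodes a.lt)
  refine ⟨r, hr'.1, hr'.2, fun x hx => ?_⟩
  induction hn : a.lvl x using Nat.strong_induction_on generalizing x with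
  | _ n ih =>
    by_cases h : ∃ y, a.lt y x
    · obtain ⟨y, hy⟩ := h
      rcases ih _ (hn ▸ a.lvl_lt hy) y (a.mem_of_lt _ _ hy).1 rfl with rfl | h
      · exact Or.inr hy
      · exact Or.inr (a.trans _ _ _ h hy)
    · have : x ∈ minNodes a.nodes a.lt := a.mem_minNodes.2 ⟨hx, not_exists.1 h⟩
      rw [hr] at this
      exact Or.inl this

/-- On the nodes of `a` of level less than `n`, the function `f` is an embedding into `b` that
preserves the structure in the sense of `LPOF.Le`: it may increase labels, and the nodes of `b` of
level less than `n` that it misses are above the image of a node labelled with `⊥`. -/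
structure EmbBelow (n : ℕ) (a b : LPOF V L) (f : V → V) : Prop where
  maps : ∀ x ∈ a.nodes, a.lvl x < n → f x ∈ b.nodes
  lvl_eq : ∀ x ∈ a.nodes, a.lvl x < n → b.lvl (f x) = a.lvl x
  inj : ∀ x ∈ a.nodes, a.lvl x < n → ∀ y ∈ a.nodes, a.lvl y < n → f x = f y → x = y
  lt_iff : ∀ x ∈ a.nodes, a.lvl x < n → ∀ y ∈ a.nodes, a.lvl y < n →
    (a.lt x y ↔ b.lt (f x) (f y))
  label_le : ∀ x ∈ a.nodes, a.lvl x < n → a.label x ≤ b.label (f x)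
  form_iff : ∀ x ∈ a.nodes, a.lvl x < n → ∀ v,
    (b.form (f x)).Holds v ↔ (a.form x).Holds (v ∘ f)
  cover : ∀ y ∈ b.nodes, b.lvl y < n → (∃ x ∈ a.nodes, a.lvl x < n ∧ f x = y) ∨
    ∃ z ∈ a.bots, a.lvl z < n ∧ b.lt (f z) y

/-- `f` is an isomorphism of `a` with an LPOF that is below `b`. -/
def Emb (a b : LPOF V L) (f : V → V) : Prop := ∀ n, EmbBelow n a b f

theorem holds_form_congr (a : LPOF V L) {x : V} (hx : x ∈ a.nodes) {v w : V → Bool}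
    (h : ∀ y, a.lt y x → v y = w y) : (a.form x).Holds v ↔ (a.form x).Holds w :=
  Formula.holds_congr _ _ _ fun y hy => h y (a.form_free x hx hy)

theorem EmbBelow.congr {n : ℕ} {f g : V → V} (h : EmbBelow n a b f)
    (hfg : ∀ x ∈ a.nodes, a.lvl x < n → g x = f x) : EmbBelow n a b g where
  maps x hx hn := hfg x hx hn ▸ h.maps x hx hn
  lvl_eq x hx hn := hfg x hx hn ▸ h.lvl_eq x hx hn
  inj x hx hn y hy hm e := h.inj x hx hn y hy hm (by rwa [← hfg x hx hn, ← hfg y hy hm])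
  lt_iff x hx hn y hy hm := by rw [hfg x hx hn, hfg y hy hm, h.lt_iff x hx hn y hy hm]
  label_le x hx hn := hfg x hx hn ▸ h.label_le x hx hn
  form_iff x hx hn v := by
    rw [hfg x hx hn, h.form_iff x hx hn v]
    refine a.holds_form_congr hx fun y hy => ?_
    simp only [Function.comp_apply, hfg y (a.mem_of_lt _ _ hy).1 ((a.lvl_lt hy).trans hn)]
  cover y hy hn := by
    rcases h.cover y hy hn with ⟨x, hx, hxn, rfl⟩ | ⟨z, hz, hzn, hlt⟩
    · exact Or.inl ⟨x, hx, hxn, hfg x hx hxn⟩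
    · exact Or.inr ⟨z, hz, hzn, by rwa [hfg z hz.1 hzn]⟩

theorem Emb.congr {f g : V → V} (h : Emb a b f) (hfg : ∀ x ∈ a.nodes, g x = f x) : Emb a b g :=
  fun n => (h n).congr fun x hx _ => hfg x hx

theorem EmbBelow.comp {n : ℕ} {f g : V → V} (hg : EmbBelow n b c g) (hf : EmbBelow n a b f) :
    EmbBelow n a c (g ∘ f) := by
  have hl : ∀ x ∈ a.nodes, a.lvl x < n → b.lvl (f x) < n := fun x hx hn => by
    rwa [hf.lvl_eq x hx hn]
  refine ⟨fun x hx hn => ?_, fun x hx hn => ?_, fun x hx hn y hy hm e => ?_,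
    fun x hx hn y hy hm => ?_, fun x hx hn => ?_, fun x hx hn v => ?_, fun y hy hn => ?_⟩
  · exact hg.maps _ (hf.maps x hx hn) (hl x hx hn)
  · rw [Function.comp_apply, hg.lvl_eq _ (hf.maps x hx hn) (hl x hx hn), hf.lvl_eq x hx hn]
  · exact hf.inj x hx hn y hy hm
      (hg.inj _ (hf.maps x hx hn) (hl x hx hn) _ (hf.maps y hy hm) (hl y hy hm) e)
  · rw [hf.lt_iff x hx hn y hy hm,
      hg.lt_iff _ (hf.maps x hx hn) (hl x hx hn) _ (hf.maps y hy hm) (hl y hy hm)]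
    rfl
  · exact (hf.label_le x hx hn).trans (hg.label_le _ (hf.maps x hx hn) (hl x hx hn))
  · rw [Function.comp_apply, hg.form_iff _ (hf.maps x hx hn) (hl x hx hn), hf.form_iff x hx hn]
    rfl
  · rcases hg.cover y hy hn with ⟨w, hw, hwn, rfl⟩ | ⟨w, hw, hwn, hlt⟩
    · rcases hf.cover w hw hwn with ⟨x, hx, hxn, rfl⟩ | ⟨z, hz, hzn, hlt⟩
      · exact Or.inl ⟨x, hx, hxn, rfl⟩
      · exact Or.inr ⟨z, hz, hzn,
          (hg.lt_iff _ (hf.maps z hz.1 hzn) (hl z hz.1 hzn) _ hw hwn).1 hlt⟩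
    · rcases hf.cover w hw.1 hwn with ⟨x, hx, hxn, rfl⟩ | ⟨z, hz, hzn, hlt'⟩
      -- Labels only grow, so a node whose image is labelled `⊥` is itself labelled `⊥`.
      · exact Or.inr ⟨x, ⟨hx, le_bot_iff.1 (hw.2 ▸ hf.label_le x hx hxn)⟩, hxn, hlt⟩
      · exact Or.inr ⟨z, hz, hzn, c.trans _ _ _
          ((hg.lt_iff _ (hf.maps z hz.1 hzn) (hl z hz.1 hzn) _ hw.1 hwn).1 hlt') hlt⟩

theorem Emb.comp {f g : V → V} (hg : Emb b c g) (hf : Emb a b f) : Emb a c (g ∘ f) :=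
  fun n => (hg n).comp (hf n)

section EmbFields

variable {f : V → V} (h : Emb a b f)
include h

theorem Emb.maps {x : V} (hx : x ∈ a.nodes) : f x ∈ b.nodes :=
  (h _).maps x hx (Nat.lt_succ_self _)

theorem Emb.lvl_eq {x : V} (hx : x ∈ a.nodes) : b.lvl (f x) = a.lvl x :=
  (h _).lvl_eq x hx (Nat.lt_succ_self _)

theorem Emb.injOn : Set.InjOn f a.nodes := fun x hx y hy e =>
  (h (max (a.lvl x) (a.lvl y) + 1)).inj x hx (by omega) y hy (by omega) e

theorem Emb.lt_iff {x y : V} (hx : x ∈ a.nodes) (hy : y ∈ a.nodes) :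
    a.lt x y ↔ b.lt (f x) (f y) :=
  (h (max (a.lvl x) (a.lvl y) + 1)).lt_iff x hx (by omega) y hy (by omega)

theorem Emb.label_le {x : V} (hx : x ∈ a.nodes) : a.label x ≤ b.label (f x) :=
  (h _).label_le x hx (Nat.lt_succ_self _)

theorem Emb.form_iff {x : V} (hx : x ∈ a.nodes) (v : V → Bool) :
    (b.form (f x)).Holds v ↔ (a.form x).Holds (v ∘ f) :=
  (h _).form_iff x hx (Nat.lt_succ_self _) v

theorem Emb.cover {y : V} (hy : y ∈ b.nodes) :
    (∃ x ∈ a.nodes, f x = y) ∨ ∃ z ∈ a.bots, b.lt (f z) y := by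
  rcases (h _).cover y hy (Nat.lt_succ_self _) with ⟨x, hx, -, e⟩ | ⟨z, hz, -, e⟩
  · exact Or.inl ⟨x, hx, e⟩
  · exact Or.inr ⟨z, hz, e⟩

/-- If `y` were missed, `f x` would lie above the image of a `⊥`-node, although nothing in `a` is
above a `⊥`-node. -/
theorem Emb.down {x y : V} (hx : x ∈ a.nodes) (hy : b.lt y (f x)) : ∃ w ∈ a.nodes, f w = y := by
  refine (h.cover (b.mem_of_lt _ _ hy).1).resolve_right ?_
  rintro ⟨z, hz, hlt⟩
  exact a.not_lt_of_label_eq_bot hz.2 ((h.lt_iff hz.1 hx).2 (b.trans _ _ _ hlt hy))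

end EmbFields

/-- Preservation of levels comes for free, because covering makes the image downward closed. -/
theorem Emb.of_cover {f : V → V} (maps : ∀ x ∈ a.nodes, f x ∈ b.nodes)
    (inj : Set.InjOn f a.nodes)
    (lt_iff : ∀ x ∈ a.nodes, ∀ y ∈ a.nodes, (a.lt x y ↔ b.lt (f x) (f y)))
    (label_le : ∀ x ∈ a.nodes, a.label x ≤ b.label (f x))
    (form_iff : ∀ x ∈ a.nodes, ∀ v, (b.form (f x)).Holds v ↔ (a.form x).Holds (v ∘ f))
    (cover : ∀ y ∈ b.nodes, (∃ x ∈ a.nodes, f x = y) ∨ ∃ z ∈ a.bots, b.lt (f z) y) :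
    Emb a b f := by
  have hl : ∀ x ∈ a.nodes, b.lvl (f x) = a.lvl x := fun x hx => by
    refine level_map a.mem_of_lt maps lt_iff (fun x hx y hy => ?_) hx
    refine (cover y (b.mem_of_lt _ _ hy).1).resolve_right ?_
    rintro ⟨z, hz, hlt⟩
    exact a.not_lt_of_label_eq_bot hz.2 ((lt_iff z hz.1 x hx).2 (b.trans _ _ _ hlt hy))
  refine fun n => ⟨fun x hx _ => maps x hx, fun x hx _ => hl x hx,
    fun x hx _ y hy _ e => inj hx hy e, fun x hx _ y hy _ => lt_iff x hx y hy,
    fun x hx _ => label_le x hx, fun x hx _ => form_iff x hx, fun y hy hn => ?_⟩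
  rcases cover y hy with ⟨x, hx, rfl⟩ | ⟨z, hz, hlt⟩
  · exact Or.inl ⟨x, hx, hl x hx ▸ hn, rfl⟩
  · exact Or.inr ⟨z, hz, hl z hz.1 ▸ (b.lvl_lt hlt).trans hn, hlt⟩

/-- The root of `b` is in `a`, and the successor equation propagates the alternative from an
immediate predecessor of `y` to `y`. -/
theorem Le.cover (h : a.Le b) {y : V} (hy : y ∈ b.nodes) :
    y ∈ a.nodes ∨ ∃ z ∈ a.bots, b.lt z y := by
  obtain ⟨r, hr, -, hroot⟩ := b.exists_root
  have hra : r ∈ a.nodes := by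
    obtain ⟨q, hq, -, -⟩ := a.exists_root
    rcases hroot q (h.nodes_subset hq) with rfl | hlt
    · exact hq
    · exact h.down_closed q hq hlt
  induction hn : b.lvl y using Nat.strong_induction_on generalizing y with
  | _ n ih =>
    rcases hroot y hy with rfl | hlt
    · exact Or.inl hra
    obtain ⟨z, -, hz⟩ := b.exists_immSucc hlt
    rcases ih _ (hn ▸ b.lvl_lt hz.1) (b.mem_of_lt _ _ hz.1).1 rfl with hza | ⟨w, hw, hwz⟩
    · by_cases hya : y ∈ immSucc a.lt z
      · exact Or.inl (a.mem_of_lt _ _ hya.1).2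
      · rw [h.succ_eq z hza] at hya
        have := not_not.1 fun hh => hya ⟨hz, hh⟩
        obtain ⟨w, hw, hlt⟩ := Set.mem_iUnion₂.1 this
        exact Or.inr ⟨w, hw, hlt⟩
    · exact Or.inr ⟨w, hw, b.trans _ _ _ hwz hz.1⟩

theorem Le.emb (h : a.Le b) : Emb a b id :=
  .of_cover (fun _ hx => h.nodes_subset hx) (Set.injOn_id _)
    (fun x hx y hy => (h.lt_iff x y).trans (and_iff_left ⟨hx, hy⟩)) h.label_le
    (fun x hx v => (Formula.equivalent_iff.1 (h.form_eq x hx) v).symm)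
    (fun y hy => (h.cover hy).imp (fun h => ⟨y, h, rfl⟩) id)

theorem Emb.le (h : Emb a b id) : a.Le b := by
  have down : ∀ y ∈ a.nodes, below b.lt y ⊆ a.nodes := fun y hy x hx => by
    obtain ⟨w, hw, rfl⟩ := h.down hy hx
    exact hw
  have lt_iff : ∀ x y, a.lt x y ↔ b.lt x y ∧ x ∈ a.nodes ∧ y ∈ a.nodes := fun x y =>
    ⟨fun hxy => have hm := a.mem_of_lt _ _ hxy; ⟨(h.lt_iff hm.1 hm.2).1 hxy, hm⟩,
      fun hxy => (h.lt_iff hxy.2.1 hxy.2.2).2 hxy.1⟩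
  refine ⟨fun x hx => h.maps hx, down, lt_iff, fun x hx => h.label_le hx,
    fun x hx => Formula.equivalent_iff.2 fun v => (h.form_iff hx v).symm, fun x hx => ?_⟩
  ext y
  simp only [Set.mem_sdiff, Set.mem_iUnion, not_exists, exists_prop, not_and]
  constructor
  · intro hy
    have hm := (a.mem_of_lt _ _ hy.1).2
    refine ⟨⟨((lt_iff x y).1 hy.1).1, ?_⟩, fun z hz hlt => ?_⟩
    · rintro ⟨z, hxz, hzy⟩
      have hz := down y hm hzy
      exact hy.2 ⟨z, (lt_iff _ _).2 ⟨hxz, hx, hz⟩, (lt_iff _ _).2 ⟨hzy, hz, hm⟩⟩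
    · exact a.not_lt_of_label_eq_bot hz.2 ((lt_iff z y).2 ⟨hlt, hz.1, hm⟩)
  · rintro ⟨hy, hz⟩
    rcases h.cover (b.mem_of_lt _ _ hy.1).2 with ⟨_, hm, rfl⟩ | ⟨z, hz', hlt⟩
    · refine ⟨(lt_iff _ _).2 ⟨hy.1, hx, hm⟩, ?_⟩
      rintro ⟨z, hxz, hzy⟩
      exact hy.2 ⟨z, ((lt_iff _ _).1 hxz).1, ((lt_iff _ _).1 hzy).1⟩
    · exact absurd hlt (hz z hz')

theorem Le.refl (a : LPOF V L) : a.Le a :=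
  Emb.le <| .of_cover (fun _ hx => hx) (Set.injOn_id _) (fun _ _ _ _ => Iff.rfl)
    (fun _ _ => le_rfl) (fun _ _ _ => Iff.rfl) fun y hy => Or.inl ⟨y, hy, rfl⟩

theorem Le.trans (hab : a.Le b) (hbc : b.Le c) : a.Le c := (hbc.emb.comp hab.emb).le

theorem Iso.exists_emb (h : Iso a b) : ∃ f, Emb a b f := by
  obtain ⟨f, hf, hlt, hlab, hform⟩ := h
  refine ⟨f, .of_cover hf.mapsTo hf.injOn hlt (fun x hx => (hlab x hx).ge) (fun x hx v => ?_)
    fun y hy => Or.inl (hf.surjOn hy)⟩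
  rw [Formula.equivalent_iff.1 (hform x hx) v, Formula.holds_rename]

theorem Emb.iso {f : V → V} (h : Emb a b f) (hsurj : ∀ y ∈ b.nodes, ∃ x ∈ a.nodes, f x = y)
    (hlab : ∀ x ∈ a.nodes, b.label (f x) = a.label x) : Iso a b :=
  ⟨f, ⟨fun _ hx => h.maps hx, h.injOn, hsurj⟩, fun _ hx _ hy => h.lt_iff hx hy, hlab,
    fun x hx => Formula.equivalent_iff.2 fun v => by
      rw [h.form_iff hx v, Formula.holds_rename]⟩

/-! ### Renaming the nodes -/

/-- The image of an LPOF under a function that is injective on the nodes. -/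
noncomputable def map [Nonempty V] (a : LPOF V L) (f : V → V) (hf : Set.InjOn f a.nodes) :
    LPOF V L :=
  have inv : ∀ x ∈ a.nodes, Function.invFunOn f a.nodes (f x) = x := hf.leftInvOn_invFunOn
  have lt_iff : ∀ x ∈ a.nodes, ∀ y ∈ a.nodes,
      (a.lt x y ↔ ∃ x' y', a.lt x' y' ∧ f x' = f x ∧ f y' = f y) := fun x hx y hy =>
    ⟨fun h => ⟨x, y, h, rfl, rfl⟩, fun ⟨x', y', h, h1, h2⟩ => by
      rwa [← hf (a.mem_of_lt _ _ h).1 hx h1, ← hf (a.mem_of_lt _ _ h).2 hy h2]⟩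
  have trans : ∀ u v w, (∃ x y, a.lt x y ∧ f x = u ∧ f y = v) →
      (∃ x y, a.lt x y ∧ f x = v ∧ f y = w) → ∃ x y, a.lt x y ∧ f x = u ∧ f y = w := by
    rintro _ _ _ ⟨x, y, h, rfl, rfl⟩ ⟨y', z, h', e, rfl⟩
    obtain rfl := hf (a.mem_of_lt _ _ h').1 (a.mem_of_lt _ _ h).2 e
    exact ⟨x, z, a.trans _ _ _ h h', rfl, rfl⟩
  have irrefl : ∀ u, ¬ ∃ x y, a.lt x y ∧ f x = u ∧ f y = u := by
    rintro _ ⟨x, y, h, rfl, e⟩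
    obtain rfl := hf (a.mem_of_lt _ _ h).2 (a.mem_of_lt _ _ h).1 e
    exact a.irrefl _ h
  have below_eq : ∀ x ∈ a.nodes, below (fun u v => ∃ x y, a.lt x y ∧ f x = u ∧ f y = v) (f x) =
      f '' below a.lt x := by
    intro x hx
    ext u
    constructor
    · rintro ⟨y, x', h, rfl, e⟩
      obtain rfl := hf (a.mem_of_lt _ _ h).2 hx e
      exact ⟨y, h, rfl⟩
    · rintro ⟨y, h, rfl⟩
      exact ⟨y, x, h, rfl, rfl⟩
  have finb : ∀ u ∈ f '' a.nodes,
      (below (fun u v => ∃ x y, a.lt x y ∧ f x = u ∧ f y = v) u).Finite := by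
    rintro _ ⟨x, hx, rfl⟩
    rw [below_eq x hx]
    exact (a.finitely_preceded x hx).image f
  { nodes := f '' a.nodes
    lt := fun u v => ∃ x y, a.lt x y ∧ f x = u ∧ f y = v
    label := fun u => a.label (Function.invFunOn f a.nodes u)
    form := fun u => (a.form (Function.invFunOn f a.nodes u)).rename f
    countable := a.countable.image f
    mem_of_lt := by
      rintro _ _ ⟨x, y, h, rfl, rfl⟩
      exact ⟨⟨x, (a.mem_of_lt _ _ h).1, rfl⟩, ⟨y, (a.mem_of_lt _ _ h).2, rfl⟩⟩
    irrefl := irrefl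
    trans := trans
    finitely_preceded := finb
    level_finite := by
      refine fun n => ((a.level_finite n).image f).subset ?_
      rintro _ ⟨⟨x, hx, rfl⟩, hn⟩
      refine ⟨x, ⟨hx, ?_⟩, rfl⟩
      rw [← hn]
      refine (level_map a.mem_of_lt (fun x hx => Set.mem_image_of_mem f hx) lt_iff ?_ hx).symm
      rintro x hx _ ⟨w, w', h, rfl, -⟩
      exact ⟨w, (a.mem_of_lt _ _ h).1, rfl⟩
    single_rooted := by
      obtain ⟨r, hr, hmin, hroot⟩ := a.exists_root
      refine ⟨f r, Set.ext fun u => ?_⟩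
      rw [mem_minNodes_iff trans irrefl finb]
      constructor
      · rintro ⟨⟨x, hx, rfl⟩, h⟩
        rcases hroot x hx with rfl | hlt
        · rfl
        · exact absurd ⟨r, x, hlt, rfl, rfl⟩ (h (f r))
      · rintro rfl
        refine ⟨⟨r, hr, rfl⟩, ?_⟩
        rintro _ ⟨x, y, h, -, e⟩
        obtain rfl := hf (a.mem_of_lt _ _ h).2 hr e
        exact hmin _ h
    succ_of_bot := by
      rintro _ ⟨x, hx, rfl⟩ h
      rw [inv x hx] at h
      refine Set.eq_empty_iff_forall_notMem.2 ?_
      rintro _ ⟨⟨x', y, hlt, e, rfl⟩, -⟩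
      obtain rfl := hf (a.mem_of_lt _ _ hlt).1 hx e
      exact a.not_lt_of_label_eq_bot h hlt
    form_sat := by
      rintro _ ⟨x, hx, rfl⟩
      obtain ⟨v, hv⟩ := a.form_sat x hx
      refine ⟨v ∘ Function.invFunOn f a.nodes, ?_⟩
      rw [inv x hx, Formula.holds_rename]
      refine (a.holds_form_congr hx fun y hy => ?_).1 hv
      simp only [Function.comp_apply, inv y (a.mem_of_lt _ _ hy).1]
    form_free := by
      rintro _ ⟨x, hx, rfl⟩
      rw [inv x hx, Formula.free_rename, below_eq x hx]
      exact Set.image_mono (a.form_free x hx)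
    form_imp := by
      rintro _ _ ⟨x, y, h, rfl, rfl⟩ v hv
      rw [inv _ (a.mem_of_lt _ _ h).2, Formula.holds_rename] at hv
      rw [inv _ (a.mem_of_lt _ _ h).1, Formula.holds_rename]
      exact a.form_imp x y h _ hv }

theorem map_label [Nonempty V] (a : LPOF V L) {f : V → V} (hf : Set.InjOn f a.nodes) {x : V}
    (hx : x ∈ a.nodes) : (a.map f hf).label (f x) = a.label x :=
  congrArg a.label (hf.leftInvOn_invFunOn hx)

theorem emb_map [Nonempty V] (a : LPOF V L) (f : V → V) (hf : Set.InjOn f a.nodes) :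
    Emb a (a.map f hf) f := by
  refine .of_cover (fun x hx => ⟨x, hx, rfl⟩) hf (fun x hx y hy => ⟨fun h => ⟨x, y, h, rfl, rfl⟩,
    ?_⟩) (fun x hx => (a.map_label hf hx).ge) (fun x hx v => ?_) fun y hy => Or.inl hy
  · rintro ⟨x', y', h, h1, h2⟩
    rwa [← hf (a.mem_of_lt _ _ h).1 hx h1, ← hf (a.mem_of_lt _ _ h).2 hy h2]
  · have inv : Function.invFunOn f a.nodes (f x) = x := hf.leftInvOn_invFunOn hx
    simp only [map, inv, Formula.holds_rename]

theorem iso_map [Nonempty V] (a : LPOF V L) (f : V → V) (hf : Set.InjOn f a.nodes) :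
    Iso a (a.map f hf) :=
  (a.emb_map f hf).iso (fun _ hy => hy) fun _ hx => a.map_label hf hx

theorem Emb.map_le [Nonempty V] {f : V → V} (h : Emb a b f) : (a.map f h.injOn).Le b := by
  have hm := a.emb_map f h.injOn
  refine Emb.le (.of_cover ?_ (Set.injOn_id _) ?_ ?_ ?_ fun y hy => ?_)
  · rintro _ ⟨x, hx, rfl⟩
    exact h.maps hx
  · rintro _ ⟨x, hx, rfl⟩ _ ⟨y, hy, rfl⟩
    rw [← hm.lt_iff hx hy]
    exact h.lt_iff hx hy
  · rintro _ ⟨x, hx, rfl⟩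
    rw [a.map_label _ hx]
    exact h.label_le hx
  · rintro _ ⟨x, hx, rfl⟩ v
    exact (h.form_iff hx v).trans (hm.form_iff hx v).symm
  · rcases h.cover hy with ⟨x, hx, rfl⟩ | ⟨z, hz, hlt⟩
    · exact Or.inl ⟨f x, ⟨x, hx, rfl⟩, rfl⟩
    · exact Or.inr ⟨f z, ⟨⟨z, hz.1, rfl⟩, (a.map_label _ hz.1).trans hz.2⟩, hlt⟩

/-- Extend the inverse of `f` from its image to all of `b` by fresh nodes. Infinitely many remain
unused, so the extension can be iterated. -/
theorem Emb.exists_le [Nonempty V] {f : V → V} (h : Emb a b f) (ha : a.nodesᶜ.Infinite) :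
    ∃ b' : LPOF V L, Iso b b' ∧ a.Le b' ∧ b'.nodesᶜ.Infinite := by
  have inv : ∀ x ∈ a.nodes, Function.invFunOn f a.nodes (f x) = x := h.injOn.leftInvOn_invFunOn
  have hinj : Set.InjOn (Function.invFunOn f a.nodes) (f '' a.nodes) := by
    rintro _ ⟨x, hx, rfl⟩ _ ⟨y, hy, rfl⟩ e
    rw [inv x hx, inv y hy] at e
    rw [e]
  have himg : Function.invFunOn f a.nodes '' (f '' a.nodes) = a.nodes := by
    rw [Set.image_image]
    exact (Set.image_congr inv).trans (Set.image_id _)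
  obtain ⟨k, hk, hkf, hinf⟩ := hinj.exists_extension b.countable (himg.symm ▸ ha)
  refine ⟨b.map k hk, b.iso_map k hk, Emb.le (((b.emb_map k hk).comp h).congr fun x hx => ?_), hinf⟩
  exact ((hkf ⟨x, hx, rfl⟩).trans (inv x hx)).symm

theorem exists_iso_infinite_compl [Infinite V] (a : LPOF V L) :
    ∃ a' : LPOF V L, Iso a a' ∧ a'.nodesᶜ.Infinite := by
  obtain ⟨k, hk, -, hinf⟩ := (Set.injOn_empty (id : V → V)).exists_extension a.countable
    (by simpa using Set.infinite_univ)
  exact ⟨a.map k hk, a.iso_map k hk, hinf⟩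

/-! ### Antisymmetry -/

theorem Emb.iterate {k : V → V} (h : Emb a a k) (n : ℕ) : Emb a a k^[n] := by
  induction n with
  | zero => exact (Le.refl a).emb
  | succ n ih => exact ih.comp h

/-- The orbit of `x` stays in one finite level; a repetition in it is cancelled down to `x` by
injectivity. -/
theorem Emb.exists_iterate_eq {k : V → V} (h : Emb a a k) {x : V} (hx : x ∈ a.nodes) :
    ∃ m, k^[m + 1] x = x := by
  obtain ⟨i, j, hij, e⟩ := (a.level_finite (a.lvl x)).exists_lt_map_eq_of_forall_mem
    (f := fun i : ℕ => k^[i] x) fun i => show _ ∈ {y | y ∈ a.nodes ∧ a.lvl y = a.lvl x} from ⟨(h.iterate i).maps hx, (h.iterate i).lvl_eq hx⟩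
  obtain ⟨m, rfl⟩ := Nat.exists_eq_add_of_lt hij
  refine ⟨m, (h.iterate i).injOn ((h.iterate _).maps hx) hx ?_⟩
  rw [← Function.iterate_add_apply]
  exact e.symm

/-- Periodicity under `f ∘ g` gives surjectivity; labels increase around a cycle of `g ∘ f`, hence
are constant on it. -/
theorem Emb.iso_of_emb {f g : V → V} (hf : Emb a b f) (hg : Emb b a g) : Iso a b := by
  refine hf.iso (fun y hy => ?_) fun x hx => le_antisymm ?_ (hf.label_le hx)
  · obtain ⟨m, hm⟩ := (hf.comp hg).exists_iterate_eq hy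
    rw [Function.iterate_succ_apply'] at hm
    exact ⟨_, hg.maps (((hf.comp hg).iterate m).maps hy), hm⟩
  · obtain ⟨m, hm⟩ := (hg.comp hf).exists_iterate_eq hx
    refine (hg.label_le (hf.maps hx)).trans
      ((((hg.comp hf).iterate m).label_le ((hg.comp hf).maps hx)).trans ?_)
    rw [← Function.iterate_succ_apply, hm]

/-! ### Limits of embeddings -/

theorem EmbBelow.mono {m n : ℕ} {f : V → V} (h : EmbBelow n a b f) (hmn : m ≤ n) :
    EmbBelow m a b f where
  maps x hx hl := h.maps x hx (hl.trans_le hmn)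
  lvl_eq x hx hl := h.lvl_eq x hx (hl.trans_le hmn)
  inj x hx hl y hy hk := h.inj x hx (hl.trans_le hmn) y hy (hk.trans_le hmn)
  lt_iff x hx hl y hy hk := h.lt_iff x hx (hl.trans_le hmn) y hy (hk.trans_le hmn)
  label_le x hx hl := h.label_le x hx (hl.trans_le hmn)
  form_iff x hx hl := h.form_iff x hx (hl.trans_le hmn)
  cover y hy hl := by
    rcases h.cover y hy (hl.trans_le hmn) with ⟨x, hx, hxn, rfl⟩ | ⟨z, hz, hzn, hlt⟩
    · exact Or.inl ⟨x, hx, h.lvl_eq x hx hxn ▸ hl, rfl⟩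
    · exact Or.inr ⟨z, hz, h.lvl_eq z hz.1 hzn ▸ (b.lvl_lt hlt).trans hl, hlt⟩

/-- The values `f t x` eventually lie in one finite level of `b`, so the ultrafilter selects one of
them. Only finitely many nodes have level below `n`, so the selections agree there with a single `f
t`. -/
theorem exists_emb_limit {T : Type*} (U : Ultrafilter T) (f : T → V → V)
    (h : ∀ n, ∀ᶠ t in (U : Filter T), EmbBelow n a b (f t)) :
    ∃ g, Emb a b g ∧
      ∀ n, ∀ᶠ t in (U : Filter T), ∀ x ∈ a.nodes, a.lvl x < n → g x = f t x := by
  have key : ∀ x, ∃ y, x ∈ a.nodes → ∀ᶠ t in (U : Filter T), y = f t x := by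
    intro x
    by_cases hx : x ∈ a.nodes
    · have hex : ∀ᶠ t in (U : Filter T), ∃ y ∈ {y | y ∈ b.nodes ∧ b.lvl y = a.lvl x}, y = f t x :=
        (h (a.lvl x + 1)).mono fun t ht =>
          ⟨_, ⟨ht.maps x hx (Nat.lt_succ_self _), ht.lvl_eq x hx (Nat.lt_succ_self _)⟩, rfl⟩
      obtain ⟨y, -, hy⟩ := (Ultrafilter.eventually_exists_mem_iff (b.level_finite (a.lvl x))).1 hex
      exact ⟨y, fun _ => hy⟩
    · exact ⟨x, fun h => absurd h hx⟩
  choose g hg using key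
  have agree : ∀ n, ∀ᶠ t in (U : Filter T), ∀ x ∈ a.nodes, a.lvl x < n → g x = f t x := by
    intro n
    have := (Filter.eventually_all_finite (a.finite_lvl_lt n)).2 fun x hx => hg x hx.1
    exact this.mono fun t ht x hx hn => ht x ⟨hx, hn⟩
  refine ⟨g, fun n => ?_, agree⟩
  obtain ⟨t, ht, ht'⟩ := ((h n).and (agree n)).exists
  exact ht.congr ht'

theorem exists_emb_of_forall_embBelow (h : ∀ n, ∃ f, EmbBelow n a b f) : ∃ f, Emb a b f := by
  choose f hf using h
  obtain ⟨g, hg, -⟩ := exists_emb_limit (a := a) (b := b) (Filter.hyperfilter ℕ) f fun n => by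
    refine (Filter.Eventually.filter_mono Nat.hyperfilter_le_atTop
      (Filter.eventually_ge_atTop n)).mono fun t ht => (hf t).mono ht
  exact ⟨g, hg⟩

/-! ### Stabilisation -/

theorem Le.embBelow_of_subset {n : ℕ} (h : a.Le b)
    (hsub : ∀ x ∈ b.nodes, b.lvl x < n → x ∈ a.nodes ∧ b.label x ≤ a.label x) :
    EmbBelow n b a id where
  maps x hx hn := (hsub x hx hn).1
  lvl_eq x hx hn := (h.emb.lvl_eq (hsub x hx hn).1).symm
  inj _ _ _ _ _ _ e := e
  lt_iff x hx hn y hy hm := (h.emb.lt_iff (hsub x hx hn).1 (hsub y hy hm).1).symm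
  label_le x hx hn := (hsub x hx hn).2
  form_iff x hx hn v := (h.emb.form_iff (hsub x hx hn).1 v).symm
  cover y hy hn := Or.inl ⟨y, h.nodes_subset hy, (h.emb.lvl_eq hy).trans_lt hn, rfl⟩

/-- Passing from `a` to a larger element of `P` changes nothing on the levels less than `n`. -/
def Stable (P : Set (LPOF V L)) (n : ℕ) (a : LPOF V L) : Prop :=
  ∀ b ∈ P, a.Le b → EmbBelow n b a id

/-- Once the levels below `n` are fixed, level `n` gains no more nodes; it remains to maximise the
labels on finitely many nodes. -/
theorem exists_stable [WellFoundedGT L] (P : Set (LPOF V L)) (n : ℕ) :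
    ∀ a ∈ P, ∃ b ∈ P, a.Le b ∧ Stable P n b := by
  induction n with
  | zero =>
    exact fun a ha => ⟨a, ha, Le.refl a, fun b _ hab => hab.embBelow_of_subset
      fun x _ h => absurd h (Nat.not_lt_zero _)⟩
  | succ n ih =>
    intro a ha
    obtain ⟨a₁, ha₁, hle₁, hst⟩ := ih a ha
    let S := {x | x ∈ a₁.nodes ∧ a₁.lvl x < n + 1}
    have : Finite S := (a₁.finite_lvl_lt (n + 1)).to_subtype
    obtain ⟨_, ⟨b, ⟨hb, hab⟩, rfl⟩, hmax⟩ :=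
      (show WellFounded (fun f g : S → L => g < f) from
        (Function.wellFoundedLT (ι := S) (α := Lᵒᵈ)).wf).has_min
        ((fun (b : LPOF V L) (x : S) => b.label x) '' {b | b ∈ P ∧ a₁.Le b})
        ⟨_, a₁, ⟨ha₁, Le.refl a₁⟩, rfl⟩
    refine ⟨b, hb, hle₁.trans hab, fun c hc hbc => hbc.embBelow_of_subset fun x hx hn => ?_⟩
    have hac := hab.trans hbc
    -- A new node `x` would lie above a `⊥`-node `z` of level below `n`. By stability `z` keeps its
    -- label in `c`, so nothing lies above it.
    have hx₁ : x ∈ a₁.nodes := by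
      refine (hac.cover hx).resolve_right ?_
      rintro ⟨z, hz, hlt⟩
      have hlab := (hst c hc hac).label_le z (hac.nodes_subset hz.1)
        ((c.lvl_lt hlt).trans_le (Nat.le_of_lt_succ hn))
      exact c.not_lt_of_label_eq_bot (le_bot_iff.1 (hlab.trans hz.2.le)) hlt
    refine ⟨hab.nodes_subset hx₁, ?_⟩
    have hle : (fun x : S => b.label x) ≤ fun x : S => c.label x := fun y =>
      hbc.label_le y (hab.nodes_subset y.2.1)
    have heq := eq_of_le_of_not_lt hle (hmax _ ⟨c, ⟨hc, hac⟩, rfl⟩)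
    exact (congrFun heq ⟨x, hx₁, (hac.emb.lvl_eq hx₁).symm.trans_lt hn⟩).ge

end LPOF

/-! ### The ascending chain condition and unions of chains -/

/-- The supremum of a strictly ascending sequence would have infinitely many elements below it. -/
theorem wellFoundedGT_of_finite_below {L : Type*} [PartialOrder L]
    (hL : IsPointedDcpo (fun l m : L => l ≤ m)) (hfin : ∀ l : L, {m : L | m < l}.Finite) :
    WellFoundedGT L := by
  refine ⟨RelEmbedding.wellFounded_iff_isEmpty.2 ⟨fun e => ?_⟩⟩
  have hmono : StrictMono e := fun i j h => e.map_rel_iff.2 h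
  obtain ⟨s, hs, -⟩ := hL.exists_sup (Set.range e)
    (hmono.monotone.directed_le.directedOn_range)
  refine Set.infinite_range_of_injective hmono.injective ((hfin s).subset ?_)
  rintro _ ⟨n, rfl⟩
  exact (hmono n.lt_succ_self).trans_le (hs _ ⟨n + 1, rfl⟩)

namespace LPOF

variable {V L : Type*} [PartialOrder L] [OrderBot L]

/-- The union of a chain of LPOFs: each finite part of it comes from a member of the chain. -/
theorem exists_chain_union [WellFoundedGT L] {ι : Type*} [LinearOrder ι] [Nonempty ι]
    (a : ι → LPOF V L) (ha : ∀ i j, i ≤ j → (a i).Le (a j)) :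
    ∃ s : LPOF V L, (∀ i, (a i).Le s) ∧ ∀ n, ∃ i, EmbBelow n s (a i) id := by
  classical
  have hst : ∀ n i, ∃ j, i ≤ j ∧ ∀ k, j ≤ k → EmbBelow n (a k) (a j) id := by
    intro n i
    obtain ⟨_, ⟨j, rfl⟩, -, hj⟩ := exists_stable (Set.range a) n (a i) ⟨i, rfl⟩
    rcases le_total i j with h | h
    · exact ⟨j, h, fun k hk => hj _ ⟨k, rfl⟩ (ha j k hk)⟩
    · exact ⟨i, le_rfl, fun k hk => ((ha j i h).emb n).comp
        (hj _ ⟨k, rfl⟩ (ha j k (h.trans hk)))⟩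
  let N : Set V := ⋃ i, (a i).nodes
  let lt : V → V → Prop := fun x y => ∃ i, (a i).lt x y
  have hmemN : ∀ {i x}, x ∈ (a i).nodes → x ∈ N := fun h => Set.mem_iUnion.2 ⟨_, h⟩
  have up : ∀ {i j}, i ≤ j → ∀ {x y}, (a i).lt x y → (a j).lt x y := fun hij x y h =>
    (((ha _ _ hij).lt_iff x y).1 h).1
  have down : ∀ {i x y}, y ∈ (a i).nodes → lt x y → (a i).lt x y := by
    rintro i x y hy ⟨j, h⟩
    rcases le_total i j with hij | hij
    · exact ((ha _ _ hij).lt_iff x y).2 ⟨h, (ha _ _ hij).down_closed y hy h, hy⟩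
    · exact up hij h
  have above_idx : ∀ {x}, x ∈ N → ∀ i, ∃ j, i ≤ j ∧ x ∈ (a j).nodes := by
    intro x hx i
    obtain ⟨j, hj⟩ := Set.mem_iUnion.1 hx
    exact ⟨max i j, le_max_left _ _, (ha _ _ (le_max_right i j)).nodes_subset hj⟩
  -- The label of each node is eventually constant; `idx x` will be an index from which on this
  -- holds.
  have hidx : ∀ x, ∃ i, x ∈ N → x ∈ (a i).nodes ∧ ∀ j, i ≤ j → (a j).label x = (a i).label x := by
    intro x
    by_cases hx : x ∈ N
    · obtain ⟨i, hi⟩ := Set.mem_iUnion.1 hx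
      obtain ⟨j, hij, hj⟩ := hst ((a i).lvl x + 1) i
      have hxj := (ha i j hij).nodes_subset hi
      refine ⟨j, fun _ => ⟨hxj, fun k hk => le_antisymm ?_ ((ha j k hk).label_le x hxj)⟩⟩
      have hxk := (ha j k hk).nodes_subset hxj
      refine (hj k hk).label_le x hxk ?_
      exact (Nat.lt_succ_iff.2 ((ha i k (hij.trans hk)).emb.lvl_eq hi).le)
    · exact ⟨Classical.arbitrary ι, fun h => absurd h hx⟩
  choose idx hidx using hidx
  have label_eq : ∀ {x}, x ∈ N → ∀ i, ∃ j, i ≤ j ∧ x ∈ (a j).nodes ∧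
      (a (idx x)).label x = (a j).label x := by
    intro x hx i
    exact ⟨max i (idx x), le_max_left _ _,
      (ha _ _ (le_max_right i (idx x))).nodes_subset (hidx x hx).1,
      ((hidx x hx).2 _ (le_max_right _ _)).symm⟩
  have form_eq : ∀ {i x}, x ∈ (a i).nodes → ∀ v,
      ((a (idx x)).form x).Holds v ↔ ((a i).form x).Holds v := by
    intro i x hx v
    have hx' := (hidx x (hmemN hx)).1
    have h1 := (ha _ _ (le_max_left i (idx x))).form_eq x hx
    have h2 := (ha _ _ (le_max_right i (idx x))).form_eq x hx'
    rw [Formula.equivalent_iff] at h1 h2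
    rw [h1, h2]
  have mem : ∀ x y, lt x y → x ∈ N ∧ y ∈ N := fun x y ⟨i, h⟩ =>
    ⟨hmemN ((a i).mem_of_lt _ _ h).1, hmemN ((a i).mem_of_lt _ _ h).2⟩
  have irrefl : ∀ x, ¬ lt x x := fun x ⟨i, h⟩ => (a i).irrefl x h
  have trans : ∀ x y z, lt x y → lt y z → lt x z := by
    rintro x y z hxy ⟨i, h⟩
    exact ⟨i, (a i).trans _ _ _ (down ((a i).mem_of_lt _ _ h).1 hxy) h⟩
  have finb : ∀ x ∈ N, (below lt x).Finite := by
    intro x hx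
    obtain ⟨i, hi⟩ := Set.mem_iUnion.1 hx
    exact ((a i).finitely_preceded x hi).subset fun y hy => down hi hy
  have lvl : ∀ {i x}, x ∈ (a i).nodes → level N lt x = (a i).lvl x := by
    intro i x hx
    exact level_map (f := id) (a i).mem_of_lt (fun _ h => hmemN h)
      (fun x _ y hy => ⟨fun h => ⟨i, h⟩, fun h => down hy h⟩)
      (fun x hx y hy => ⟨y, ((a i).mem_of_lt _ _ (down hx hy)).1, rfl⟩) hx
  -- One member contains everything below level `n`, which makes the levels of the union finite.
  have hstN : ∀ n, ∃ j, ∀ x ∈ N, level N lt x < n →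
      x ∈ (a j).nodes ∧ (a (idx x)).label x ≤ (a j).label x := by
    intro n
    obtain ⟨j, -, hj⟩ := hst n (Classical.arbitrary ι)
    refine ⟨j, fun x hx hn => ?_⟩
    obtain ⟨k, hk, hxk, e⟩ := label_eq hx j
    rw [lvl hxk] at hn
    exact ⟨(hj k hk).maps x hxk hn, e ▸ (hj k hk).label_le x hxk hn⟩
  have lvlfin : ∀ n, {x | x ∈ N ∧ level N lt x = n}.Finite := by
    intro n
    obtain ⟨j, hj⟩ := hstN (n + 1)
    refine ((a j).level_finite n).subset ?_
    rintro x ⟨hx, hn⟩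
    have hxj := (hj x hx (by omega)).1
    exact ⟨hxj, (lvl hxj).symm.trans hn⟩
  let s : LPOF V L :=
    { nodes := N
      lt := lt
      label := fun x => (a (idx x)).label x
      form := fun x => (a (idx x)).form x
      countable := by
        -- As `ι` may be uncountable, countability comes from the finite levels.
        refine (Set.countable_iUnion fun n => (lvlfin n).countable).mono fun x hx => ?_
        exact Set.mem_iUnion.2 ⟨level N lt x, hx, rfl⟩
      mem_of_lt := mem
      irrefl := irrefl
      trans := trans
      finitely_preceded := finb
      level_finite := lvlfin
      single_rooted := by
        obtain ⟨i⟩ := ‹Nonempty ι›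
        obtain ⟨r, hr, hmin, -⟩ := (a i).exists_root
        refine ⟨r, Set.ext fun x => ?_⟩
        rw [mem_minNodes_iff trans irrefl finb]
        constructor
        · rintro ⟨hx, hx'⟩
          obtain ⟨j, hij, hxj⟩ := above_idx hx i
          obtain ⟨q, hq, -, hroot⟩ := (a j).exists_root
          have h1 : x = q := (hroot x hxj).resolve_right fun h => hx' q ⟨j, h⟩
          have h2 : r = q := (hroot r ((ha i j hij).nodes_subset hr)).resolve_right fun h =>
            hmin q (down hr ⟨j, h⟩)
          exact h1.trans h2.symm
        · rintro rfl
          exact ⟨hmemN hr, fun y hy => hmin y (down hr hy)⟩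
      succ_of_bot := by
        intro x hx hlab
        refine Set.eq_empty_iff_forall_notMem.2 ?_
        rintro y ⟨⟨i, h⟩, -⟩
        obtain ⟨j, hj, -, e⟩ := label_eq hx i
        exact (a j).not_lt_of_label_eq_bot (e ▸ hlab) (up hj h)
      form_sat := fun x hx => (a (idx x)).form_sat x (hidx x hx).1
      form_free := fun x hx y hy => ⟨idx x, (a (idx x)).form_free x (hidx x hx).1 hy⟩
      form_imp := by
        rintro x y ⟨i, h⟩ v hv
        have hm := (a i).mem_of_lt _ _ h
        exact (form_eq hm.1 v).2 ((a i).form_imp x y h v ((form_eq hm.2 v).1 hv)) }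
  have hle : ∀ i, (a i).Le s := by
    intro i
    refine Emb.le (.of_cover (fun _ h => hmemN h) (Set.injOn_id _)
      (fun x _ y hy => ⟨fun h => ⟨i, h⟩, fun h => down hy h⟩) (fun x hx => ?_)
      (fun x hx v => form_eq hx v) fun y hy => ?_)
    · obtain ⟨j, hj, -, e⟩ := label_eq (hmemN hx) i
      exact ((ha i j hj).label_le x hx).trans e.ge
    · obtain ⟨j, hj, hyj⟩ := above_idx hy i
      exact ((ha i j hj).cover hyj).imp (fun h => ⟨y, h, rfl⟩)
        fun ⟨z, hz, h⟩ => ⟨z, hz, j, h⟩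
  refine ⟨s, hle, fun n => ?_⟩
  obtain ⟨j, hj⟩ := hstN n
  exact ⟨j, (hle j).embBelow_of_subset hj⟩

end LPOF

/-! ### The order on pomsets through embeddings -/

namespace Pom

variable {V L : Type*} [PartialOrder L] [OrderBot L] {a b : LPOF V L}

open LPOF

theorem mk_eq_mk : mk a = mk b ↔ Iso a b := Quotient.eq

/-- Forward, test on a copy of `a` that leaves infinitely many nodes free; backward, `Emb.exists_le`
extends any such representative. Transitivity then reduces to composing embeddings. -/
theorem mk_le_mk [Infinite V] : (mk a).Le (mk b) ↔ ∃ f, Emb a b f := by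
  constructor
  · intro h
    obtain ⟨a', haa', hinf⟩ := a.exists_iso_infinite_compl
    obtain ⟨b', hb', hle⟩ := h a' (mk_eq_mk.2 (iso_symm haa')) hinf
    obtain ⟨f, hf⟩ := haa'.exists_emb
    obtain ⟨g, hg⟩ := (mk_eq_mk.1 hb').exists_emb
    exact ⟨_, hg.comp (hle.emb.comp hf)⟩
  · rintro ⟨f, hf⟩ a' ha' hinf
    obtain ⟨g, hg⟩ := (mk_eq_mk.1 ha').exists_emb
    obtain ⟨b', hb', hle, -⟩ := (hf.comp hg).exists_le hinf
    exact ⟨b', mk_eq_mk.2 (iso_symm hb'), hle⟩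

theorem exists_mk (A : Pom V L) : ∃ a, mk a = A := Quotient.exists_rep A

theorem le_refl (A : Pom V L) : A.Le A := fun a ha _ => ⟨a, ha, Le.refl a⟩

theorem le_trans [Infinite V] {A B C : Pom V L} (h : A.Le B) (h' : B.Le C) : A.Le C := by
  obtain ⟨a, rfl⟩ := exists_mk A
  obtain ⟨b, rfl⟩ := exists_mk B
  obtain ⟨c, rfl⟩ := exists_mk C
  obtain ⟨f, hf⟩ := mk_le_mk.1 h
  obtain ⟨g, hg⟩ := mk_le_mk.1 h'
  exact mk_le_mk.2 ⟨_, hg.comp hf⟩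

theorem le_antisymm [Infinite V] {A B : Pom V L} (h : A.Le B) (h' : B.Le A) : A = B := by
  obtain ⟨a, rfl⟩ := exists_mk A
  obtain ⟨b, rfl⟩ := exists_mk B
  obtain ⟨f, hf⟩ := mk_le_mk.1 h
  obtain ⟨g, hg⟩ := mk_le_mk.1 h'
  exact mk_eq_mk.2 (hf.iso_of_emb hg)

theorem mk_le_mk_of_le [Infinite V] (h : a.Le b) : (mk a).Le (mk b) := mk_le_mk.2 ⟨id, h.emb⟩

end Pom

/-! ### Least element, suprema and choice of representatives -/

namespace LPOF

variable {V L : Type*} [PartialOrder L] [OrderBot L]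

/-- The LPOF whose only node is labelled with `⊥`. -/
def single (L : Type*) [PartialOrder L] [OrderBot L] (r : V) : LPOF V L where
  nodes := {r}
  lt _ _ := False
  label _ := ⊥
  form _ := .tru
  countable := Set.countable_singleton r
  mem_of_lt _ _ h := h.elim
  irrefl _ h := h
  trans _ _ _ h _ := h
  finitely_preceded _ _ := Set.finite_empty
  level_finite _ := (Set.finite_singleton r).subset fun _ h => h.1
  single_rooted := ⟨r, Set.ext fun _ => and_iff_left <|
    Set.eq_empty_iff_forall_notMem.2 fun _ h => h.1⟩
  succ_of_bot _ _ _ := Set.eq_empty_iff_forall_notMem.2 fun _ h => h.1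
  form_sat _ _ := ⟨fun _ => true, trivial⟩
  form_free _ _ := Set.empty_subset _
  form_imp _ _ h := h.elim

theorem exists_emb_single (r : V) (b : LPOF V L) : ∃ f, Emb (single L r) b f := by
  obtain ⟨q, hq, hmin, hroot⟩ := b.exists_root
  refine ⟨fun _ => q, .of_cover (fun _ _ => hq) ?_ (fun _ _ _ _ => ?_) (fun _ _ => bot_le)
    (fun _ _ v => ?_) fun y hy => ?_⟩
  · rintro x rfl y rfl -
    rfl
  · exact ⟨False.elim, hmin _⟩
  · obtain ⟨w, hw⟩ := b.form_sat q hq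
    -- The formula at the root is satisfiable and has no variables, so it is valid.
    exact iff_of_true ((b.holds_form_congr hq fun y hy => absurd hy (hmin y)).1 hw) trivial
  · rcases hroot y hy with rfl | h
    · exact Or.inl ⟨r, rfl, rfl⟩
    · exact Or.inr ⟨r, ⟨rfl, rfl⟩, h⟩

/-- The union of a chain is its supremum, also up to isomorphism. -/
theorem isSupOf_chain_union [Infinite V] {ι : Type*} {a : ι → LPOF V L} {s : LPOF V L}
    (hle : ∀ i, (a i).Le s) (hs : ∀ n, ∃ i, EmbBelow n s (a i) id) :
    IsSupOf LPOF.Le (Set.range a) s ∧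
      IsSupOf Pom.Le (Set.range fun i => Pom.mk (a i)) (Pom.mk s) := by
  refine ⟨⟨?_, fun b hb => Emb.le fun n => ?_⟩, ⟨?_, fun B hB => ?_⟩⟩
  · rintro _ ⟨i, rfl⟩
    exact hle i
  · obtain ⟨i, hi⟩ := hs n
    exact ((hb _ ⟨i, rfl⟩).emb n).comp hi
  · rintro _ ⟨i, rfl⟩
    exact Pom.mk_le_mk_of_le (hle i)
  · obtain ⟨b, rfl⟩ := Pom.exists_mk B
    -- Embeddings of different members into `b` need not be compatible; compactness replaces gluing.
    refine Pom.mk_le_mk.2 (exists_emb_of_forall_embBelow fun n => ?_)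
    obtain ⟨i, hi⟩ := hs n
    obtain ⟨f, hf⟩ := Pom.mk_le_mk.1 (hB _ ⟨i, rfl⟩)
    exact ⟨_, (hf n).comp hi⟩

theorem exists_chain_isSupOf_directed [Infinite V] [WellFoundedGT L] (D : Set (Pom V L))
    (hD : D.Nonempty) (hdir : DirectedOn Pom.Le D) :
    ∃ a : ℕ → LPOF V L, (∀ n, Pom.mk (a n) ∈ D) ∧ (∀ m n, m ≤ n → (a m).Le (a n)) ∧
      ∃ s : LPOF V L, IsSupOf LPOF.Le (Set.range a) s ∧ IsSupOf Pom.Le D (Pom.mk s) := by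
  -- The unused nodes let upper bounds in `D` be realised by representatives extending a given one.
  let P : Set (LPOF V L) := {a | Pom.mk a ∈ D ∧ a.nodesᶜ.Infinite}
  obtain ⟨a₀, ha₀⟩ : P.Nonempty := by
    obtain ⟨A, hA⟩ := hD
    obtain ⟨a, rfl⟩ := Pom.exists_mk A
    obtain ⟨a', haa', hinf⟩ := a.exists_iso_infinite_compl
    exact ⟨a', Pom.mk_eq_mk.2 haa' ▸ hA, hinf⟩
  have step : ∀ n (a : P), ∃ b : P, a.1.Le b ∧ Stable P n b.1 := fun n a => by
    obtain ⟨b, hb, h⟩ := exists_stable P n a.1 a.2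
    exact ⟨⟨b, hb⟩, h⟩
  choose next hnext hstable using step
  let a : ℕ → P := fun n => Nat.rec (next 0 ⟨a₀, ha₀⟩) (fun n x => next (n + 1) x) n
  have hst : ∀ n, Stable P n (a n).1 := fun n => by
    cases n with
    | zero => exact hstable _ _
    | succ n => exact hstable _ _
  have hmono : ∀ m n, m ≤ n → (a m).1.Le (a n).1 := fun m n h => by
    induction h with
    | refl => exact Le.refl _
    | step _ ih => exact ih.trans (hnext _ _)
  obtain ⟨s, hle, hs⟩ := exists_chain_union (fun n => (a n).1) hmono
  obtain ⟨hsup, hsup'⟩ := isSupOf_chain_union hle hs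
  refine ⟨fun n => (a n).1, fun n => (a n).2.1, hmono, s, hsup, fun B hB => ?_, fun B hB => ?_⟩
  · obtain ⟨b, rfl⟩ := Pom.exists_mk B
    refine Pom.mk_le_mk.2 (exists_emb_of_forall_embBelow fun n => ?_)
    obtain ⟨C, hC, hBC, hAC⟩ := hdir _ hB _ (a n).2.1
    obtain ⟨c, rfl⟩ := Pom.exists_mk C
    obtain ⟨g, hg⟩ := Pom.mk_le_mk.1 hAC
    obtain ⟨c', hcc', hle', hinf⟩ := hg.exists_le (a n).2.2
    rw [Pom.mk_eq_mk.2 hcc'] at hC hBC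
    obtain ⟨f, hf⟩ := Pom.mk_le_mk.1 hBC
    -- Below level `n`: from `b` into `c'`, by stability back into `a n`, and on into `s`.
    exact ⟨_, ((hle n).emb n).comp ((hst n c' ⟨hC, hinf⟩ hle').comp (hf n))⟩
  · refine hsup'.2 B ?_
    rintro _ ⟨n, rfl⟩
    exact hB _ (a n).2.1

/-- Order and formulae of both are inherited from `s`, so only nodes and labels have to be compared.
-/
theorem Le.of_le_of_subset {a b s : LPOF V L} (ha : a.Le s) (hb : b.Le s)
    (h : ∀ x ∈ a.nodes, x ∈ b.nodes ∧ a.label x ≤ b.label x) : a.Le b := by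
  refine Emb.le (.of_cover (fun x hx => (h x hx).1) (Set.injOn_id _) (fun x hx y hy => ?_)
    (fun x hx => (h x hx).2) (fun x hx v => ?_) fun y hy => ?_)
  · exact (ha.emb.lt_iff hx hy).trans (hb.emb.lt_iff (h x hx).1 (h y hy).1).symm
  · exact (hb.emb.form_iff (h x hx).1 v).symm.trans (ha.emb.form_iff hx v)
  · rcases ha.cover (hb.nodes_subset hy) with hya | ⟨z, hz, hlt⟩
    · exact Or.inl ⟨y, hya, rfl⟩
    · exact Or.inr ⟨z, hz, (hb.emb.lt_iff (h z hz.1).1 hy).2 hlt⟩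

/-- A family of pomsets that increases along a linear order and is bounded above has an
increasing family of representatives. -/
theorem exists_monotone_reps [Infinite V] {ι : Type*} [LinearOrder ι] (A : ι → Pom V L)
    (hA : ∀ i j, i ≤ j → (A i).Le (A j)) (s : LPOF V L) (hs : ∀ i, (A i).Le (Pom.mk s)) :
    ∃ a : ι → LPOF V L, (∀ i, Pom.mk (a i) = A i) ∧ ∀ i j, i ≤ j → (a i).Le (a j) := by
  classical
  choose a ha using fun i => Pom.exists_mk (A i)
  obtain rfl : (fun i => Pom.mk (a i)) = A := funext ha
  -- Coherence says that the images in `s` increase with the index, labels included.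
  let Coh : Finset ι → (ι → V → V) → Prop := fun F f => (∀ i ∈ F, Emb (a i) s (f i)) ∧
    ∀ i ∈ F, ∀ j ∈ F, i ≤ j → ∀ x ∈ (a i).nodes,
      ∃ y ∈ (a j).nodes, f j y = f i x ∧ (a i).label x ≤ (a j).label y
  have fin : ∀ F : Finset ι, ∃ f, Coh F f := by
    intro F
    -- A new least index is embedded through the previous minimum of `F`, which leaves the earlier
    -- choices intact.
    induction F using Finset.induction_on_min with
    | empty => exact ⟨fun _ => id, by simp, by simp⟩
    | insert i F hi ih =>
      obtain ⟨f, hf, hcoh⟩ := ih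
      have hiF : i ∉ F := fun h => lt_irrefl i (hi i h)
      have hne : ∀ j ∈ F, j ≠ i := fun j hj e => hiF (e ▸ hj)
      obtain ⟨g, hg, hgcoh⟩ : ∃ g, Emb (a i) s g ∧ ∀ j ∈ F, ∀ x ∈ (a i).nodes,
          ∃ y ∈ (a j).nodes, f j y = g x ∧ (a i).label x ≤ (a j).label y := by
        rcases F.eq_empty_or_nonempty with rfl | hF
        · obtain ⟨g, hg⟩ := Pom.mk_le_mk.1 (hs i)
          exact ⟨g, hg, by simp⟩
        · obtain ⟨g, hg⟩ := Pom.mk_le_mk.1 (hA i _ (hi _ (F.min'_mem hF)).le)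
          refine ⟨_, (hf _ (F.min'_mem hF)).comp hg, fun j hj x hx => ?_⟩
          obtain ⟨y, hy, e, hl⟩ := hcoh _ (F.min'_mem hF) j hj (F.min'_le j hj) _ (hg.maps hx)
          exact ⟨y, hy, e, (hg.label_le hx).trans hl⟩
      refine ⟨Function.update f i g, fun j hj => ?_, fun j hj k hk hjk x hx => ?_⟩
      · rcases Finset.mem_insert.1 hj with rfl | hj
        · simpa using hg
        · simpa [hne j hj] using hf j hj
      · rcases Finset.mem_insert.1 hj with rfl | hjF <;>
          rcases Finset.mem_insert.1 hk with rfl | hkF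
        · exact ⟨x, hx, rfl, le_rfl⟩
        · simpa [hne k hkF] using hgcoh k hkF x hx
        · exact absurd (hi j hjF) hjk.not_gt
        · simpa [hne j hjF, hne k hkF] using hcoh j hjF k hkF hjk x hx
  choose f hf hcoh using fin
  have hev : ∀ i, ∀ᶠ F : Finset ι in
      (Ultrafilter.of (Filter.atTop : Filter (Finset ι)) : Filter (Finset ι)), i ∈ F :=
    fun i => ((Filter.eventually_ge_atTop {i}).mono fun F h =>
      Finset.singleton_subset_iff.1 h).filter_mono (Ultrafilter.of_le _)
  choose g hg hagree using fun i => exists_emb_limit (Ultrafilter.of Filter.atTop)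
    (fun F => f F i) fun n => (hev i).mono fun F hi => hf F i hi n
  refine ⟨fun i => (a i).map (g i) (hg i).injOn, fun i =>
    (Pom.mk_eq_mk.2 ((a i).iso_map (g i) (hg i).injOn)).symm, fun i j hij => ?_⟩
  refine Le.of_le_of_subset (hg i).map_le (hg j).map_le ?_
  rintro _ ⟨x, hx, rfl⟩
  -- A single `F` realises both limits up to the level of `x`, so its coherence passes to `g i` and
  -- `g j`.
  obtain ⟨F, ⟨hi, hj⟩, hgi, hgj⟩ := (((hev i).and (hev j)).and ((hagree i ((a i).lvl x + 1)).and
    (hagree j ((a i).lvl x + 1)))).exists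
  obtain ⟨y, hy, e, hl⟩ := hcoh F i hi j hj hij x hx
  have hlvl : (a j).lvl y = (a i).lvl x := by
    rw [← (hf F j hj).lvl_eq hy, e, (hf F i hi).lvl_eq hx]
  have hgxy : g i x = g j y := by
    rw [hgi x hx (Nat.lt_succ_self _), hgj y hy (by omega), e]
  rw [map_label _ _ hx]
  rw [hgxy, map_label _ _ hy]
  exact ⟨⟨y, hy, rfl⟩, hl⟩

end LPOF

/-! ### The main theorem -/

theorem mainTheorem3 {V : Type*} [Infinite V] {L : Type*} [PartialOrder L] [OrderBot L]
    (hL : IsPointedDcpo (fun l m : L => l ≤ m)) (hfin : ∀ l : L, {m : L | m < l}.Finite) :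
    -- pomsets form a pointed dcpo
    IsPointedDcpo (Pom.Le : Pom V L → Pom V L → Prop) ∧
    -- a transfinite chain of pomsets has chains of representatives, and each of them yields
    -- the supremum
    (∀ (ι : Type*) [LinearOrder ι] [WellFoundedLT ι] [Nonempty ι] (A : ι → Pom V L),
      (∀ i j, i ≤ j → (A i).Le (A j)) →
        (∃ a : ι → LPOF V L, (∀ i, a i ∈ (A i).reps) ∧ ∀ i j, i ≤ j → (a i).Le (a j)) ∧
        ∀ a : ι → LPOF V L, (∀ i, a i ∈ (A i).reps) → (∀ i j, i ≤ j → (a i).Le (a j)) →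
          ∃ s : LPOF V L, IsSupOf LPOF.Le (Set.range a) s ∧
            IsSupOf Pom.Le (Set.range A) (Pom.mk s)) ∧
    -- the supremum of a directed set of pomsets is the class of the supremum of a chain of
    -- representatives of members of the set
    (∀ D : Set (Pom V L), D.Nonempty → DirectedOn Pom.Le D →
      ∃ a : ℕ → LPOF V L, (∀ n, Pom.mk (a n) ∈ D) ∧ (∀ m n, m ≤ n → (a m).Le (a n)) ∧
        ∃ s : LPOF V L, IsSupOf LPOF.Le (Set.range a) s ∧ IsSupOf Pom.Le D (Pom.mk s)) := by
  have : WellFoundedGT L := wellFoundedGT_of_finite_below hL hfin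
  have hbot : ∀ B : Pom V L, (Pom.mk (LPOF.single L (Classical.arbitrary V))).Le B := fun B => by
    obtain ⟨b, rfl⟩ := Pom.exists_mk B
    exact Pom.mk_le_mk.2 (LPOF.exists_emb_single _ b)
  refine ⟨⟨Pom.le_refl, fun _ _ _ => Pom.le_trans, fun _ _ => Pom.le_antisymm, fun D hdir => ?_,
    ⟨_, hbot⟩⟩, fun ι _ _ _ A hA => ⟨?_, fun a haA ha => ?_⟩, LPOF.exists_chain_isSupOf_directed⟩
  · rcases D.eq_empty_or_nonempty with rfl | hD
    · exact ⟨_, fun _ h => h.elim, fun B _ => hbot B⟩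
    · obtain ⟨-, -, -, s, -, hs⟩ := LPOF.exists_chain_isSupOf_directed D hD hdir
      exact ⟨_, hs⟩
  -- The directed case supplies the common upper bound into which all terms are embedded.
  · have hdir : DirectedOn Pom.Le (Set.range A) := by
      rintro _ ⟨i, rfl⟩ _ ⟨j, rfl⟩
      exact ⟨_, ⟨max i j, rfl⟩, hA _ _ (le_max_left _ _), hA _ _ (le_max_right _ _)⟩
    obtain ⟨-, -, -, s, -, hs⟩ :=
      LPOF.exists_chain_isSupOf_directed _ (Set.range_nonempty A) hdir
    exact LPOF.exists_monotone_reps A hA s fun i => hs.1 _ ⟨i, rfl⟩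
  · obtain rfl : (fun i => Pom.mk (a i)) = A := funext haA
    obtain ⟨s, hle, hs⟩ := LPOF.exists_chain_union a ha
    exact ⟨s, LPOF.isSupOf_chain_union hle hs⟩
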